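/- Let $X$ be a real Banach lattice and let $Y\subset X$ be a closed ideal, i.e. a closed linear subspace such that $|x|\le|y|$ and $y\in Y$ imply $x\in Y$; equip $X/Y$ with the quotient norm and the lattice operations for which the quotient map $X\to X/Y$ is a lattice homomorphism, so that $X/Y$ is a Banach lattice. A Banach space is called weakly compactly generated (WCG) if it is the closed linear span of some weakly compact subset. A Banach lattice is called weakly compactly generated as a lattice (LWCG) if it has a weakly compact subset $K$ such that the smallest closed sublattice (closed linear subspace stable under $\vee$ and $\wedge$) containing $K$ is the whole space. A Banach lattice is called order continuous if every decreasing net with infimum $0$ converges to $0$ in norm. Then: (i) If $X$ is LWCG, then $X/Y$ is LWCG. (ii) If $Y$ is reflexive and $X/Y$ is LWCG, then $X$ is LWCG. (iii) If $X$ is order continuous, $Y$ contains no subspace isomorphic (linearly homeomorphic) to $\ell_1$, and $X/Y$ is WCG, then $X$ is WCG. -/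

import Mathlib

/-! Throughout, a (real) Banach lattice is a type `X` with
`[NormedAddCommGroup X] [NormedSpace ℝ X] [CompleteSpace X] [Lattice X] [IsOrderedAddMonoid X]
[IsOrderedModule ℝ X] [HasSolidNorm X]`: a complete normed real vector lattice such that
`|x| ≤ |y|` implies `‖x‖ ≤ ‖y‖`. -/

namespace BanachLattice

/-- A linear subspace `Y` of a vector lattice is an (order) ideal if `x ∈ Y` and `|y| ≤ |x|` imply
`y ∈ Y`. Closedness is stated separately, as `IsClosed (Y : Set X)`. -/
class IsIdeal {X : Type*} [AddCommGroup X] [Module ℝ X] [Lattice X]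
    (Y : Submodule ℝ X) : Prop where
  solid : LatticeOrderedAddCommGroup.IsSolid (Y : Set X)

section Quotient

/-! ### The quotient of a Banach lattice by a closed ideal

The lattice operations on `X ⧸ Y` are the ones that make the quotient map `X → X ⧸ Y` a lattice
homomorphism. With them and the quotient norm, `X ⧸ Y` is a Banach lattice. -/

theorem IsIdeal.mem_of_abs_le_add {X : Type*} [AddCommGroup X] [Module ℝ X] [Lattice X]
    [IsOrderedAddMonoid X] {Y : Submodule ℝ X} [IsIdeal Y] {u v w : X}
    (hu : u ∈ Y) (hv : v ∈ Y) (h : |w| ≤ |u| + |v|) : w ∈ Y := by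
  have hs := IsIdeal.solid (Y := Y)
  have hu' : |u| ∈ Y := hs hu (by rw [abs_abs])
  have hv' : |v| ∈ Y := hs hv (by rw [abs_abs])
  refine hs (Y.add_mem hu' hv') ?_
  rwa [abs_of_nonneg (add_nonneg (abs_nonneg u) (abs_nonneg v))]

theorem abs_sup_sub_sup_le {X : Type*} [AddCommGroup X] [Lattice X] [IsOrderedAddMonoid X]
    (a b c d : X) : |a ⊔ c - b ⊔ d| ≤ |a - b| + |c - d| := by
  have e : a ⊔ c - b ⊔ d = (a ⊔ c - b ⊔ c) + (b ⊔ c - b ⊔ d) := by abel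
  rw [e]
  refine (abs_add_le _ _).trans (add_le_add (abs_sup_sub_sup_le_abs a b c) ?_)
  rw [sup_comm b c, sup_comm b d]
  exact abs_sup_sub_sup_le_abs c d b

theorem abs_inf_sub_inf_le {X : Type*} [AddCommGroup X] [Lattice X] [IsOrderedAddMonoid X]
    (a b c d : X) : |a ⊓ c - b ⊓ d| ≤ |a - b| + |c - d| := by
  have e : a ⊓ c - b ⊓ d = (a ⊓ c - b ⊓ c) + (b ⊓ c - b ⊓ d) := by abel
  rw [e]
  refine (abs_add_le _ _).trans (add_le_add (abs_inf_sub_inf_le_abs a b c) ?_)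
  rw [inf_comm b c, inf_comm b d]
  exact abs_inf_sub_inf_le_abs c d b

variable {X : Type*} [AddCommGroup X] [Module ℝ X] [Lattice X] [IsOrderedAddMonoid X]
  (Y : Submodule ℝ X) [IsIdeal Y]

instance quotientMax : Max (X ⧸ Y) where
  max := Quotient.map₂ (· ⊔ ·) fun a b hab c d hcd => by
    have hab' : a - b ∈ Y := (Submodule.quotientRel_def Y).1 hab
    have hcd' : c - d ∈ Y := (Submodule.quotientRel_def Y).1 hcd
    exact (Submodule.quotientRel_def Y).2
      (IsIdeal.mem_of_abs_le_add hab' hcd' (abs_sup_sub_sup_le a b c d))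

instance quotientMin : Min (X ⧸ Y) where
  min := Quotient.map₂ (· ⊓ ·) fun a b hab c d hcd => by
    have hab' : a - b ∈ Y := (Submodule.quotientRel_def Y).1 hab
    have hcd' : c - d ∈ Y := (Submodule.quotientRel_def Y).1 hcd
    exact (Submodule.quotientRel_def Y).2
      (IsIdeal.mem_of_abs_le_add hab' hcd' (abs_inf_sub_inf_le a b c d))

/-- The quotient lattice: `q x ⊔ q y = q (x ⊔ y)`, `q x ⊓ q y = q (x ⊓ y)` for the quotient map `q`,
and `a ≤ b` means `a ⊔ b = b`. -/
instance quotientLattice : Lattice (X ⧸ Y) :=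
  Lattice.mk'
    (by rintro ⟨a⟩ ⟨b⟩; exact congrArg (Submodule.Quotient.mk (p := Y)) (sup_comm a b))
    (by rintro ⟨a⟩ ⟨b⟩ ⟨c⟩; exact congrArg (Submodule.Quotient.mk (p := Y)) (sup_assoc a b c))
    (by rintro ⟨a⟩ ⟨b⟩; exact congrArg (Submodule.Quotient.mk (p := Y)) (inf_comm a b))
    (by rintro ⟨a⟩ ⟨b⟩ ⟨c⟩; exact congrArg (Submodule.Quotient.mk (p := Y)) (inf_assoc a b c))
    (by rintro ⟨a⟩ ⟨b⟩; exact congrArg (Submodule.Quotient.mk (p := Y)) sup_inf_self)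
    (by rintro ⟨a⟩ ⟨b⟩; exact congrArg (Submodule.Quotient.mk (p := Y)) inf_sup_self)

theorem mk_sup (x y : X) :
    (Submodule.Quotient.mk (x ⊔ y) : X ⧸ Y)
      = Submodule.Quotient.mk x ⊔ Submodule.Quotient.mk y := rfl

theorem mk_inf (x y : X) :
    (Submodule.Quotient.mk (x ⊓ y) : X ⧸ Y)
      = Submodule.Quotient.mk x ⊓ Submodule.Quotient.mk y := rfl

theorem mk_abs (x : X) :
    (Submodule.Quotient.mk |x| : X ⧸ Y) = |Submodule.Quotient.mk x| := rfl

theorem mk_mono {x y : X} (h : x ≤ y) :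
    (Submodule.Quotient.mk x : X ⧸ Y) ≤ Submodule.Quotient.mk y := by
  rw [← sup_eq_right, ← mk_sup, sup_eq_right.2 h]

/-- If `q x ≤ q y`, then `q y` has a representative above `x`. -/
theorem exists_rep_ge {x y : X}
    (h : (Submodule.Quotient.mk x : X ⧸ Y) ≤ Submodule.Quotient.mk y) :
    ∃ z, x ≤ z ∧ (Submodule.Quotient.mk z : X ⧸ Y) = Submodule.Quotient.mk y :=
  ⟨x ⊔ y, le_sup_left, by rw [mk_sup, sup_eq_right.2 h]⟩

instance quotientIsOrderedAddMonoid : IsOrderedAddMonoid (X ⧸ Y) where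
  add_le_add_left := by
    rintro ⟨a⟩ ⟨b⟩ h ⟨c⟩
    obtain ⟨z, hz, hzb⟩ := exists_rep_ge Y h
    change (Submodule.Quotient.mk a : X ⧸ Y) + Submodule.Quotient.mk c
      ≤ Submodule.Quotient.mk b + Submodule.Quotient.mk c
    rw [← hzb, ← Submodule.Quotient.mk_add, ← Submodule.Quotient.mk_add]
    exact mk_mono Y (by gcongr)

instance quotientIsOrderedModule [IsOrderedModule ℝ X] : IsOrderedModule ℝ (X ⧸ Y) where
  smul_le_smul_of_nonneg_left := by
    rintro r hr ⟨a⟩ ⟨b⟩ h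
    obtain ⟨z, hz, hzb⟩ := exists_rep_ge Y h
    change r • (Submodule.Quotient.mk a : X ⧸ Y) ≤ r • (Submodule.Quotient.mk b : X ⧸ Y)
    rw [← hzb, ← Submodule.Quotient.mk_smul, ← Submodule.Quotient.mk_smul]
    exact mk_mono Y (smul_le_smul_of_nonneg_left hz hr)
  smul_le_smul_of_nonneg_right := by
    rintro ⟨b⟩ h r s hrs
    obtain ⟨z, hz, hzb⟩ := exists_rep_ge Y (x := 0) h
    change r • (Submodule.Quotient.mk b : X ⧸ Y) ≤ s • (Submodule.Quotient.mk b : X ⧸ Y)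
    rw [← hzb, ← Submodule.Quotient.mk_smul, ← Submodule.Quotient.mk_smul]
    exact mk_mono Y (smul_le_smul_of_nonneg_right hrs hz)

end Quotient

/-- The quotient norm is a lattice norm. -/
instance quotientHasSolidNorm {X : Type*} [NormedAddCommGroup X] [NormedSpace ℝ X] [Lattice X]
    [IsOrderedAddMonoid X] [HasSolidNorm X]
    (Y : Submodule ℝ X) [IsClosed (Y : Set X)] [IsIdeal Y] : HasSolidNorm (X ⧸ Y) where
  solid := by
    rintro ⟨x⟩ b h
    change |(Submodule.Quotient.mk x : X ⧸ Y)| ≤ |b| at h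
    change ‖(Submodule.Quotient.mk x : X ⧸ Y)‖ ≤ ‖b‖
    refine le_of_forall_pos_lt_add fun ε hε => ?_
    obtain ⟨y, rfl, hy⟩ := Submodule.Quotient.norm_mk_lt b hε
    have hx : (Submodule.Quotient.mk ((x ⊓ |y|) ⊔ -|y|) : X ⧸ Y) = Submodule.Quotient.mk x := by
      rw [mk_sup, mk_inf, Submodule.Quotient.mk_neg, mk_abs]
      rw [inf_eq_left.2 ((le_abs_self _).trans h), sup_eq_left]
      exact neg_le.1 ((neg_le_abs _).trans h)
    rw [← hx]
    refine lt_of_le_of_lt ((Submodule.Quotient.norm_mk_le Y _).trans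
      (norm_le_norm_of_abs_le_abs (b := y) ?_)) hy
    have h0 : -|y| ≤ |y| := neg_le_self (abs_nonneg y)
    rw [abs_le']
    exact ⟨sup_le inf_le_right h0, neg_le.1 le_sup_right⟩

section Generation

/-- `K` is weakly compact: compact in the weak topology `σ(X, X*)`. -/
def IsWeaklyCompact {X : Type*} [NormedAddCommGroup X] [NormedSpace ℝ X] (K : Set X) : Prop :=
  IsCompact (toWeakSpace ℝ X '' K)

/-- `X` is weakly compactly generated (WCG): it is the closed linear span of a weakly compact
set. -/
def IsWCG (X : Type*) [NormedAddCommGroup X] [NormedSpace ℝ X] : Prop :=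
  ∃ K : Set X, IsWeaklyCompact K ∧ (Submodule.span ℝ K).topologicalClosure = ⊤

/-- `L(A)`: the smallest closed sublattice (closed linear subspace that is stable under `⊔` and
`⊓`) containing `A`, obtained as the intersection of all of them. -/
def closedSublatticeSpan {X : Type*} [NormedAddCommGroup X] [NormedSpace ℝ X] [Lattice X]
    (A : Set X) : Submodule ℝ X :=
  sInf {Z : Submodule ℝ X | IsClosed (Z : Set X) ∧ IsSublattice (Z : Set X) ∧ A ⊆ Z}

/-- `X` is weakly compactly generated as a lattice (LWCG): `X = L(K)` for a weakly compact set
`K`. -/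
def IsLWCG (X : Type*) [NormedAddCommGroup X] [NormedSpace ℝ X] [Lattice X] : Prop :=
  ∃ K : Set X, IsWeaklyCompact K ∧ closedSublatticeSpan K = ⊤

end Generation

/-- A Banach space is reflexive if the canonical embedding into its bidual is onto. -/
def IsReflexive (E : Type*) [NormedAddCommGroup E] [NormedSpace ℝ E] : Prop :=
  Function.Surjective (NormedSpace.inclusionInDoubleDual ℝ E)

/-- `E` contains an isomorphic copy of `ℓ₁`: some linear subspace of `E` is linearly homeomorphic
to `ℓ₁`. -/
def ContainsCopyOfEllOne (E : Type*) [NormedAddCommGroup E] [NormedSpace ℝ E] : Prop :=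
  ∃ Z : Submodule ℝ E, Nonempty (lp (fun _ : ℕ => ℝ) 1 ≃L[ℝ] Z)

/-- The norm is order continuous: every nonempty downward directed set `D` with infimum `0`,
regarded as a decreasing net, converges to `0` in norm. -/
def IsOrderContinuous (X : Type*) [NormedAddCommGroup X] [Lattice X] : Prop :=
  ∀ D : Set X, D.Nonempty → DirectedOn (· ≥ ·) D → IsGLB D 0 →
    ∀ ε : ℝ, 0 < ε → ∃ x ∈ D, ∀ y ∈ D, y ≤ x → ‖y‖ < ε

end BanachLattice

/-!
Write `q : X → X ⧸ Y` for the quotient map.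

A weakly compact set that generates `X` as a lattice is mapped by `q` to one that generates `X ⧸ Y`,
because preimages of closed sublattices under `q` are closed sublattices (`IsLWCG.quotient`).

For the converse statements, a closed subspace `Z ⊇ Y` has closed image `q Z`, and `Z = X` as soon
as `q Z = X ⧸ Y`. It therefore suffices to lift a weakly compact generating set of `X ⧸ Y` to a
weakly compact set, and to generate `Y`.

* If `Y` is reflexive, then `q⁻¹ K ∩ r B` is weakly compact for each weakly compact `K`
  (`IsWeaklyCompact.preimage_inter_closedBall`): a weak-* limit `φ ∈ X**` of an ultrafilter on this
  set agrees on `Y^⊥` with some `x₀` in `X`, and `φ - x₀ ∈ Y^⊥⊥ = Y** = Y`. Adding `0` to `K` puts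
  a ball of `Y` into this set.
* If `X` is order continuous, then `Y` is a projection band
  (`IsOrderContinuous.isCompl_disjointComplement`), so `X ⧸ Y ≃ Y^d` lifts weakly compact sets. A
  maximal disjoint family `E` of positive unit vectors of `Y` generates `Y` through the order
  intervals `[0, e]` (`IsOrderContinuous.le_topologicalClosure_span`). If `Y` has no copy of `ℓ₁`,
  then bounded disjoint sequences in `Y` are weakly null, so these intervals together with `0` form
  a weakly compact set.

The last point uses that order intervals `[0, e]` are weakly compact
(`IsOrderContinuous.isWeaklyCompact_Icc`), which is proved without representation theory. Let `φ` be
the weak-* limit of an ultrafilter on `[0, e]` and let `f ≥ 0` be a functional. The square of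
`x ∈ [0, e]` in units of `e` is `sup_r (2 r x - r² e)`, and it is uniformly convex
(`square_uniform_convex`). Hence near-minimisers of `f (x²)` over the convex members of the
ultrafilter are Cauchy for `f |·|`, and their limit represents `φ` on all `g` with `|g| ≤ f`. The
set `S f` of all representing elements is closed under infima and decreases in `f`, so `inf S f`
increases with `f`; its norm limit along the directed set of all `f ≥ 0` represents `φ` on the
whole dual.
-/

open Filter Topology

namespace BanachLattice

/-! ### Weakly compact sets -/

section WeakCompactness

variable {X : Type*} [NormedAddCommGroup X] [NormedSpace ℝ X]

theorem isWeaklyCompact_iff {K : Set X} :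
    IsWeaklyCompact K ↔ ∀ F : Ultrafilter X, K ∈ F →
      ∃ x ∈ K, ∀ f : StrongDual ℝ X, Tendsto f F (𝓝 (f x)) := by
  have hinj : Function.Injective (topDualPairing ℝ X).flip := fun x y h =>
    (NormedSpace.inclusionInDoubleDualLi ℝ (E := X)).injective
      (ContinuousLinearMap.ext fun f => LinearMap.congr_fun h f)
  have key : ∀ (F : Ultrafilter X) (x : X),
      (↑(F.map (toWeakSpace ℝ X)) ≤ 𝓝 (toWeakSpace ℝ X x)) ↔
        ∀ f : StrongDual ℝ X, Tendsto f F (𝓝 (f x)) := fun F x =>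
    WeakBilin.tendsto_iff_forall_eval_tendsto (l := (F : Filter X))
      (f := fun z => toWeakSpace ℝ X z) (x := toWeakSpace ℝ X x)
      (B := (topDualPairing ℝ X).flip) hinj
  rw [IsWeaklyCompact, isCompact_iff_ultrafilter_le_nhds]
  constructor
  · intro h F hF
    obtain ⟨_, ⟨x, hx, rfl⟩, hle⟩ := h (F.map (toWeakSpace ℝ X))
      (le_principal_iff.2 (Ultrafilter.mem_map.2
        (mem_of_superset hF (Set.subset_preimage_image _ _))))
    exact ⟨x, hx, (key F x).1 hle⟩
  · intro h G hG
    obtain ⟨F, rfl⟩ : ∃ F : Ultrafilter X, F.map (toWeakSpace ℝ X) = G :=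
      ⟨G.map (toWeakSpace ℝ X).symm, by
        rw [Ultrafilter.map_map]
        exact Ultrafilter.map_id' G⟩
    have hF : K ∈ F := by
      have := le_principal_iff.1 hG
      rwa [Ultrafilter.mem_coe, Ultrafilter.mem_map,
        Set.preimage_image_eq _ (toWeakSpace ℝ X).injective] at this
    obtain ⟨x, hx, hlim⟩ := h F hF
    exact ⟨_, ⟨x, hx, rfl⟩, (key F x).2 hlim⟩

theorem IsWeaklyCompact.image {Z : Type*} [NormedAddCommGroup Z] [NormedSpace ℝ Z] {K : Set X}
    (hK : IsWeaklyCompact K) (T : X →L[ℝ] Z) : IsWeaklyCompact (T '' K) := by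
  have h := IsCompact.image hK (WeakSpace.map T).continuous
  rwa [IsWeaklyCompact, show toWeakSpace ℝ Z '' (T '' K) =
    WeakSpace.map T '' (toWeakSpace ℝ X '' K) by rw [Set.image_image, Set.image_image]; rfl]

theorem IsWeaklyCompact.union {K L : Set X} (hK : IsWeaklyCompact K) (hL : IsWeaklyCompact L) :
    IsWeaklyCompact (K ∪ L) := by
  rw [IsWeaklyCompact, Set.image_union]
  exact IsCompact.union hK hL

theorem isWeaklyCompact_singleton (x : X) : IsWeaklyCompact ({x} : Set X) := by
  rw [IsWeaklyCompact, Set.image_singleton]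
  exact isCompact_singleton

/-- The uniform boundedness principle, applied to `K` as a subset of the bidual. -/
theorem IsWeaklyCompact.exists_norm_le {K : Set X} (hK : IsWeaklyCompact K) :
    ∃ C : ℝ, ∀ x ∈ K, ‖x‖ ≤ C := by
  obtain ⟨C, hC⟩ := banach_steinhaus (g := fun k : K => NormedSpace.inclusionInDoubleDual ℝ X k)
    (fun f => by
      obtain ⟨C, hC⟩ := (show Bornology.IsBounded (f '' K) from by
        have hcont : Continuous fun z : WeakSpace ℝ X => f ((toWeakSpace ℝ X).symm z) :=
          WeakBilin.eval_continuous (topDualPairing ℝ X).flip f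
        have := (IsCompact.image hK hcont).isBounded
        rwa [Set.image_image] at this).exists_norm_le
      exact ⟨C, fun k => hC _ ⟨k, k.2, rfl⟩⟩)
  refine ⟨C, fun x hx => ?_⟩
  rw [← (NormedSpace.inclusionInDoubleDualLi ℝ (E := X)).norm_map x]
  exact hC ⟨x, hx⟩

/-- An ultrafilter containing a norm bounded set converges weak-* in the bidual. -/
theorem exists_bidual_limit {F : Ultrafilter X} {r : ℝ} (hF : Metric.closedBall (0 : X) r ∈ F) :
    ∃ φ : StrongDual ℝ (StrongDual ℝ X), ∀ f : StrongDual ℝ X, Tendsto f F (𝓝 (φ f)) := by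
  have hlim : ∀ f : StrongDual ℝ X, ∃ c, ‖c‖ ≤ r * ‖f‖ ∧ Tendsto f F (𝓝 c) := by
    intro f
    have hmem : Metric.closedBall (0 : ℝ) (r * ‖f‖) ∈ F.map f := by
      refine Ultrafilter.mem_map.2 (mem_of_superset hF fun x hx => ?_)
      rw [Set.mem_preimage, mem_closedBall_zero_iff]
      rw [mem_closedBall_zero_iff] at hx
      rw [mul_comm]
      exact (f.le_opNorm x).trans (by gcongr)
    obtain ⟨c, hc, hle⟩ := (isCompact_iff_ultrafilter_le_nhds.1
      (isCompact_closedBall (0 : ℝ) (r * ‖f‖))) (F.map f) (le_principal_iff.2 hmem)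
    exact ⟨c, mem_closedBall_zero_iff.1 hc, hle⟩
  choose φ hφ hφlim using hlim
  refine ⟨LinearMap.mkContinuous ⟨⟨φ, fun f g => ?_⟩, fun c f => ?_⟩ r hφ, hφlim⟩
  · exact tendsto_nhds_unique (hφlim (f + g)) ((hφlim f).add (hφlim g))
  · exact tendsto_nhds_unique (hφlim (c • f)) ((hφlim f).const_mul c)

end WeakCompactness

/-! ### Lifting weakly compact sets along a quotient map with reflexive kernel -/

section Quotient

variable {X : Type*} [NormedAddCommGroup X] [NormedSpace ℝ X]

/-- If `Y` is reflexive, then `Y^⊥⊥ = Y` in the bidual of `X`. -/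
theorem exists_eq_eval_of_isReflexive {Y : Submodule ℝ X} (hY : IsReflexive Y)
    (φ : StrongDual ℝ (StrongDual ℝ X))
    (hφ : ∀ f : StrongDual ℝ X, (∀ y ∈ Y, f y = 0) → φ f = 0) :
    ∃ y ∈ Y, ∀ f : StrongDual ℝ X, φ f = f y := by
  choose ext hext hnorm using fun h : StrongDual ℝ Y => exists_extension_norm_eq Y h
  have hwd : ∀ f g : StrongDual ℝ X, (∀ y : Y, f y = g y) → φ f = φ g := fun f g hfg => by
    rw [← sub_eq_zero, ← map_sub]
    exact hφ _ fun y hy => sub_eq_zero.2 (hfg ⟨y, hy⟩)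
  let ψ : StrongDual ℝ (StrongDual ℝ Y) := LinearMap.mkContinuous
    ⟨⟨fun h => φ (ext h), fun h k => by
      rw [← map_add]; exact hwd _ _ fun y => by simp [hext]⟩,
      fun c h => by
        rw [RingHom.id_apply, ← map_smul]; exact hwd _ _ fun y => by simp [hext]⟩
    ‖φ‖ fun h => by
      rw [← hnorm h]; exact φ.le_opNorm _
  obtain ⟨y, hy⟩ := hY ψ
  refine ⟨y, y.2, fun f => ?_⟩
  have h1 : ψ (f.comp Y.subtypeL) = f y := by rw [← hy]; rfl
  rw [← h1]
  exact hwd _ _ fun z => (hext (f.comp Y.subtypeL) z).symm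

/-- The quotient map by a reflexive subspace is Tauberian: bounded parts of preimages of weakly
compact sets are weakly compact. -/
theorem IsWeaklyCompact.preimage_inter_closedBall {Y : Submodule ℝ X} [IsClosed (Y : Set X)]
    (hY : IsReflexive Y) {K : Set (X ⧸ Y)} (hK : IsWeaklyCompact K) (r : ℝ) :
    IsWeaklyCompact (Y.mkQL ⁻¹' K ∩ Metric.closedBall 0 r) := by
  rw [isWeaklyCompact_iff] at hK ⊢
  intro F hF
  have hball := mem_of_superset hF Set.inter_subset_right
  obtain ⟨φ, hφ⟩ := exists_bidual_limit hball
  obtain ⟨k, hk, hlim⟩ := hK (F.map Y.mkQL)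
    (Ultrafilter.mem_map.2 (mem_of_superset hF Set.inter_subset_left))
  obtain ⟨x₀, rfl⟩ := Submodule.Quotient.mk_surjective Y k
  obtain ⟨y, hy, hφy⟩ := exists_eq_eval_of_isReflexive hY
    (φ - NormedSpace.inclusionInDoubleDual ℝ X x₀) fun f hf => by
      let h : StrongDual ℝ (X ⧸ Y) := Y.liftQL f hf
      have h1 := hlim h
      exact sub_eq_zero.2 (tendsto_nhds_unique (hφ f) h1)
  have hval : ∀ f : StrongDual ℝ X, φ f = f (x₀ + y) := fun f => by
    have := hφy f
    rw [sub_apply, NormedSpace.dual_def] at this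
    rw [map_add]; linarith
  have hr : 0 ≤ r := by
    obtain ⟨x, hx⟩ := F.nonempty_of_mem hball
    exact (norm_nonneg x).trans (mem_closedBall_zero_iff.1 hx)
  refine ⟨x₀ + y, ⟨?_, ?_⟩, fun f => hval f ▸ hφ f⟩
  · have : Y.mkQL (x₀ + y) = Submodule.Quotient.mk x₀ :=
      (Submodule.Quotient.eq Y).2 (by simpa using hy)
    rwa [Set.mem_preimage, this]
  · rw [mem_closedBall_zero_iff]
    refine NormedSpace.norm_le_dual_bound ℝ _ hr fun f => ?_
    rw [← hval f]
    refine le_of_tendsto (hφ f).norm (mem_of_superset hball fun x hx => ?_)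
    rw [mem_closedBall_zero_iff] at hx
    change ‖f x‖ ≤ r * ‖f‖
    rw [mul_comm]
    exact (f.le_opNorm x).trans (by gcongr)

theorem isClosed_map_mkQ {Y Z : Submodule ℝ X} (hYZ : Y ≤ Z) (hZ : IsClosed (Z : Set X)) :
    IsClosed (Z.map Y.mkQ : Set (X ⧸ Y)) := by
  have h : Y.mkQ ⁻¹' (Z.map Y.mkQ : Set (X ⧸ Y)) = Z := by
    have : (Z.map Y.mkQ).comap Y.mkQ = Z := by
      rw [Submodule.comap_map_mkQ, sup_eq_right.2 hYZ]
    exact congrArg (fun W : Submodule ℝ X => (W : Set X)) this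
  exact (Y.isQuotientMap_mkQ).isClosed_preimage.1 (h ▸ hZ)

theorem eq_top_of_map_mkQ_eq_top {Y Z : Submodule ℝ X} (hYZ : Y ≤ Z) (h : Z.map Y.mkQ = ⊤) :
    Z = ⊤ := by
  rw [← sup_eq_right.2 hYZ, ← Submodule.comap_map_mkQ, h, Submodule.comap_top]

end Quotient

/-! ### Lattice generation of quotients and extensions -/

section LatticeGeneration

variable {X : Type*} [NormedAddCommGroup X] [NormedSpace ℝ X] [Lattice X] [IsOrderedAddMonoid X]
  {Y : Submodule ℝ X} [IsClosed (Y : Set X)] [IsIdeal Y]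

theorem IsLWCG.quotient (h : IsLWCG X) : IsLWCG (X ⧸ Y) := by
  obtain ⟨K, hK, hgen⟩ := h
  refine ⟨Y.mkQL '' K, hK.image Y.mkQL, sInf_eq_top.2 ?_⟩
  rintro Z ⟨hZc, hZl, hKZ⟩
  have hmem : Z.comap Y.mkQ = ⊤ := by
    refine sInf_eq_top.1 hgen _ ⟨hZc.preimage Y.mkQL.continuous, ⟨?_, ?_⟩, ?_⟩
    · exact fun a ha b hb => hZl.supClosed ha hb
    · exact fun a ha b hb => hZl.infClosed ha hb
    · exact fun x hx => hKZ ⟨x, hx, rfl⟩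
  refine Submodule.eq_top_iff'.2 fun z => ?_
  obtain ⟨x, rfl⟩ := Submodule.Quotient.mk_surjective Y z
  exact (Submodule.eq_top_iff'.1 hmem x : _)

theorem isLWCG_of_isReflexive (hY : IsReflexive Y)
    (h : IsLWCG (X ⧸ Y)) : IsLWCG X := by
  obtain ⟨K, hK, hgen⟩ := h
  obtain ⟨C, hC⟩ := hK.exists_norm_le
  have hK0 := hK.union (isWeaklyCompact_singleton 0)
  refine ⟨_, hK0.preimage_inter_closedBall hY (max (C + 1) 1), sInf_eq_top.2 ?_⟩
  rintro Z ⟨hZc, hZl, hKZ⟩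
  have hYZ : Y ≤ Z := by
    intro y hy
    rcases eq_or_ne y 0 with rfl | hy0
    · exact Z.zero_mem
    have hmem : ‖y‖⁻¹ • y ∈ Z := hKZ
      ⟨Or.inr ((Submodule.Quotient.mk_eq_zero Y).2 (Y.smul_mem _ hy)), by
        rw [mem_closedBall_zero_iff, norm_smul, norm_inv, norm_norm,
          inv_mul_cancel₀ (norm_ne_zero_iff.2 hy0)]
        exact le_max_right _ _⟩
    rwa [Z.smul_mem_iff (inv_ne_zero (norm_ne_zero_iff.2 hy0))] at hmem
  refine eq_top_of_map_mkQ_eq_top hYZ (sInf_eq_top.1 hgen _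
    ⟨isClosed_map_mkQ hYZ hZc, ⟨?_, ?_⟩, fun k hk => ?_⟩)
  · rintro _ ⟨a, ha, rfl⟩ _ ⟨b, hb, rfl⟩
    exact ⟨a ⊔ b, hZl.supClosed ha hb, rfl⟩
  · rintro _ ⟨a, ha, rfl⟩ _ ⟨b, hb, rfl⟩
    exact ⟨a ⊓ b, hZl.infClosed ha hb, rfl⟩
  · obtain ⟨x, rfl, hx⟩ := Submodule.Quotient.norm_mk_lt k one_pos
    refine ⟨x, hKZ ⟨Or.inl hk, ?_⟩, rfl⟩
    rw [mem_closedBall_zero_iff]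
    exact (hx.le.trans (by gcongr; exact hC _ hk)).trans (le_max_left _ _)

end LatticeGeneration

/-! ### Order completeness of order continuous Banach lattices -/

theorem norm_le_of_nonneg_of_le {X : Type*} [NormedAddCommGroup X] [Lattice X]
    [IsOrderedAddMonoid X] [HasSolidNorm X] {a b : X} (ha : 0 ≤ a) (hab : a ≤ b) : ‖a‖ ≤ ‖b‖ :=
  norm_le_norm_of_abs_le_abs (by rwa [abs_of_nonneg ha, abs_of_nonneg (ha.trans hab)])

section OrderCompleteness

variable {X : Type*} [NormedAddCommGroup X] [NormedSpace ℝ X] [Lattice X] [IsOrderedAddMonoid X]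
  [IsOrderedModule ℝ X] [HasSolidNorm X]

theorem nonpos_of_forall_nsmul_le {z w : X} (h : ∀ n : ℕ, n • z ≤ w) : z ≤ 0 := by
  have hlim : Tendsto (fun n : ℕ => ((n : ℝ) + 1)⁻¹ • w) atTop (𝓝 0) := by
    have := (tendsto_one_div_add_atTop_nhds_zero_nat (𝕜 := ℝ)).smul_const w
    simpa using this
  refine ge_of_tendsto' hlim fun n => ?_
  have hn : (0 : ℝ) < (n : ℝ) + 1 := by positivity
  have h1 : ((n : ℝ) + 1) • z ≤ w := by
    have := h (n + 1)
    rwa [← Nat.cast_smul_eq_nsmul ℝ, Nat.cast_add, Nat.cast_one] at this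
  calc z = ((n : ℝ) + 1)⁻¹ • (((n : ℝ) + 1) • z) := by rw [inv_smul_smul₀ hn.ne']
    _ ≤ _ := smul_le_smul_of_nonneg_left h1 (by positivity)

/-- Subtracting from `D` all of its lower bounds gives a downward directed set with infimum `0`. -/
theorem IsOrderContinuous.exists_norm_sub_lt (hX : IsOrderContinuous X) {D : Set X}
    (hne : D.Nonempty) (hdir : DirectedOn (· ≥ ·) D) (hbdd : BddBelow D) {ε : ℝ} (hε : 0 < ε) :
    ∃ x ∈ D, ∀ y ∈ D, y ≤ x → ‖x - y‖ < ε := by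
  obtain ⟨x₀, hx₀⟩ := hne
  obtain ⟨a₀, ha₀⟩ := hbdd
  obtain ⟨_, ⟨x, hx, a, ha, rfl⟩, hlt⟩ :=
    hX {z | ∃ x ∈ D, ∃ a ∈ lowerBounds D, z = x - a} ⟨_, x₀, hx₀, a₀, ha₀, rfl⟩ (by
      rintro _ ⟨x, hx, a, ha, rfl⟩ _ ⟨y, hy, b, hb, rfl⟩
      obtain ⟨z, hz, hzx, hzy⟩ := hdir x hx y hy
      refine ⟨z - (a ⊔ b), ⟨z, hz, a ⊔ b, fun w hw => sup_le (ha hw) (hb hw), rfl⟩, ?_, ?_⟩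
      · exact sub_le_sub hzx le_sup_left
      · exact sub_le_sub hzy le_sup_right) (by
      constructor
      · rintro _ ⟨x, hx, a, ha, rfl⟩
        exact sub_nonneg.2 (ha hx)
      · intro z hz
        -- if `a` is a lower bound of `D`, then so is `a + z`, hence `a + n • z` for every `n`
        have hn : ∀ n : ℕ, a₀ + n • z ∈ lowerBounds D := by
          intro n
          induction n with
          | zero => simpa using ha₀
          | succ n ih =>
            intro x hx
            have := hz ⟨x, hx, _, ih, rfl⟩
            rw [succ_nsmul, ← add_assoc, add_comm]
            exact le_sub_iff_add_le.1 this
        exact nonpos_of_forall_nsmul_le (w := x₀ - a₀) fun n =>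
          le_sub_iff_add_le'.2 (hn n hx₀)) ε hε
  refine ⟨x, hx, fun y hy hyx => lt_of_le_of_lt ?_ (hlt _ ⟨x, hx, a, ha, rfl⟩ le_rfl)⟩
  exact norm_le_of_nonneg_of_le (sub_nonneg.2 hyx) (sub_le_sub_left (ha hy) x)

variable [CompleteSpace X]

theorem IsOrderContinuous.exists_isGLB_of_directedOn (hX : IsOrderContinuous X) {D : Set X}
    (hne : D.Nonempty) (hdir : DirectedOn (· ≥ ·) D) (hbdd : BddBelow D) :
    ∃ d, IsGLB D d ∧ ∀ ε > 0, ∃ x ∈ D, ∀ y ∈ D, y ≤ x → ‖y - d‖ < ε := by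
  choose x hxD hx using fun n : ℕ =>
    hX.exists_norm_sub_lt hne hdir hbdd (ε := 1 / ((n : ℝ) + 1)) (by positivity)
  have hlim0 := tendsto_one_div_add_atTop_nhds_zero_nat (𝕜 := ℝ)
  have hcauchy : CauchySeq x := by
    refine cauchySeq_of_le_tendsto_0 (fun N : ℕ => 1 / ((N : ℝ) + 1) + 1 / ((N : ℝ) + 1))
      (fun n m N hn hm => ?_) (by simpa using hlim0.add hlim0)
    obtain ⟨z, hz, hzn, hzm⟩ := hdir _ (hxD n) _ (hxD m)
    calc dist (x n) (x m) ≤ dist (x n) z + dist z (x m) := dist_triangle _ _ _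
      _ = ‖x n - z‖ + ‖x m - z‖ := by rw [dist_eq_norm, dist_comm, dist_eq_norm]
      _ ≤ _ := by
        gcongr
        · exact (hx n z hz hzn).le.trans (one_div_le_one_div_of_le (by positivity) (by gcongr))
        · exact (hx m z hz hzm).le.trans (one_div_le_one_div_of_le (by positivity) (by gcongr))
  obtain ⟨d, hd⟩ := cauchySeq_tendsto_of_complete hcauchy
  refine ⟨d, ⟨fun y hy => ?_, fun a ha => ge_of_tendsto' hd fun n => ha (hxD n)⟩, fun ε hε => ?_⟩
  · choose z hzD hzx hzy using fun n => hdir _ (hxD n) _ hy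
    refine le_of_tendsto' (f := z) (x := atTop) ?_ hzy
    have h0 : Tendsto (fun n => x n - z n) atTop (𝓝 0) :=
      squeeze_zero_norm (fun n => (hx n _ (hzD n) (hzx n)).le) hlim0
    simpa using hd.sub h0
  · have h1 : ∀ᶠ n in atTop, dist (x n) d < ε / 2 :=
      (Metric.tendsto_nhds.1 hd) _ (half_pos hε)
    have h2 : ∀ᶠ n : ℕ in atTop, 1 / ((n : ℝ) + 1) < ε / 2 :=
      hlim0.eventually (gt_mem_nhds (half_pos hε))
    obtain ⟨n, hn1, hn2⟩ := (h1.and h2).exists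
    refine ⟨x n, hxD n, fun y hy hyx => ?_⟩
    calc ‖y - d‖ = ‖(x n - d) - (x n - y)‖ := by congr 1; abel
      _ ≤ ‖x n - d‖ + ‖x n - y‖ := norm_sub_le _ _
      _ < ε := by
        rw [dist_eq_norm] at hn1
        linarith [hx n y hy hyx]

theorem IsOrderContinuous.exists_isLUB_of_directedOn (hX : IsOrderContinuous X) {D : Set X}
    (hne : D.Nonempty) (hdir : DirectedOn (· ≤ ·) D) (hbdd : BddAbove D) :
    ∃ d, IsLUB D d ∧ ∀ ε > 0, ∃ x ∈ D, ∀ y ∈ D, x ≤ y → ‖y - d‖ < ε := by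
  obtain ⟨d, hd, h⟩ := hX.exists_isGLB_of_directedOn (D := -D) hne.neg
    (fun x hx y hy => by
      obtain ⟨z, hz, h1, h2⟩ := hdir _ hx _ hy
      exact ⟨-z, by simpa using hz, neg_le.2 h1, neg_le.2 h2⟩) hbdd.neg
  refine ⟨-d, isGLB_neg.1 hd, fun ε hε => ?_⟩
  obtain ⟨x, hx, hlt⟩ := h ε hε
  refine ⟨-x, hx, fun y hy hxy => ?_⟩
  have := hlt (-y) (by simpa using hy) (neg_le.2 hxy)
  rwa [← norm_neg, neg_sub, sub_neg_eq_add, add_comm, ← sub_neg_eq_add] at this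

theorem IsOrderContinuous.exists_isLUB (hX : IsOrderContinuous X) {S : Set X}
    (hne : S.Nonempty) (hbdd : BddAbove S) : ∃ d, IsLUB S d := by
  obtain ⟨d, hd, -⟩ := hX.exists_isLUB_of_directedOn (D := supClosure S)
    (hne.mono subset_supClosure) supClosed_supClosure.directedOn
    (by rwa [BddAbove, upperBounds_supClosure])
  exact ⟨d, isLUB_supClosure.1 hd⟩

theorem IsOrderContinuous.tendsto_of_monotone (hX : IsOrderContinuous X) {u : ℕ → X}
    (hu : Monotone u) {d : X} (hd : IsLUB (Set.range u) d) : Tendsto u atTop (𝓝 d) := by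
  obtain ⟨d', hd', h⟩ := hX.exists_isLUB_of_directedOn (Set.range_nonempty u)
    (directedOn_range.2 hu.directed_le) ⟨d, hd.1⟩
  obtain rfl := hd.unique hd'
  refine Metric.tendsto_atTop.2 fun ε hε => ?_
  obtain ⟨_, ⟨n, rfl⟩, hn⟩ := h ε hε
  exact ⟨n, fun m hm => by rw [dist_eq_norm]; exact hn _ ⟨m, rfl⟩ (hu hm)⟩

theorem IsOrderContinuous.exists_tendsto_of_antitone (hX : IsOrderContinuous X) {u : ℕ → X}
    (hu : Antitone u) {b : X} (hb : ∀ n, b ≤ u n) :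
    ∃ d, Tendsto u atTop (𝓝 d) := by
  obtain ⟨d, hd⟩ := hX.exists_isLUB (S := Set.range fun n => -u n) (Set.range_nonempty _)
    ⟨-b, by rintro _ ⟨n, rfl⟩; exact neg_le_neg (hb n)⟩
  have := (hX.tendsto_of_monotone (u := fun n => -u n) (fun m n h => neg_le_neg (hu h)) hd).neg
  exact ⟨-d, by simpa using this⟩

end OrderCompleteness

/-! ### Positive functionals -/

/-- The Riesz decomposition property. -/
theorem exists_add_of_abs_le_add {X : Type*} [AddCommGroup X] [Lattice X]
    [IsOrderedAddMonoid X] {x x' y : X} (hx : 0 ≤ x) (hx' : 0 ≤ x') (h : |y| ≤ x + x') :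
    ∃ y₁ y₂, y = y₁ + y₂ ∧ |y₁| ≤ x ∧ |y₂| ≤ x' := by
  obtain ⟨h1, h2⟩ := abs_le'.1 h
  refine ⟨(y ⊓ x) ⊔ -x, y - (y ⊓ x) ⊔ -x, by abel, abs_le'.2 ⟨?_, ?_⟩, abs_le'.2 ⟨?_, ?_⟩⟩
  · exact sup_le inf_le_right (neg_le_self hx)
  · exact neg_le.1 le_sup_right
  · rw [sub_le_comm]
    exact (le_inf (sub_le_self y hx') (sub_le_iff_le_add.2 h1)).trans le_sup_left
  · rw [neg_sub, sub_le_iff_le_add']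
    refine sup_le (inf_le_left.trans (le_add_of_nonneg_right hx')) ?_
    rw [neg_le_iff_add_nonneg, add_right_comm]
    have := add_le_add_left h2 y
    rwa [neg_add_cancel, add_comm, ← add_assoc] at this

section PositiveFunctionals

variable {X : Type*} [NormedAddCommGroup X] [NormedSpace ℝ X] [Lattice X]

theorem abs_smul_le [IsOrderedModule ℝ X] (r : ℝ) (x : X) : |r • x| ≤ |r| • |x| := by
  have key : ∀ (s : ℝ) (y : X), s • y ≤ |s| • |y| := by
    intro s y
    rcases le_total 0 s with hs | hs
    · rw [abs_of_nonneg hs]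
      exact smul_le_smul_of_nonneg_left (le_abs_self y) hs
    · rw [abs_of_nonpos hs, ← neg_smul_neg]
      exact smul_le_smul_of_nonneg_left (neg_le_abs y) (neg_nonneg.2 hs)
  refine abs_le'.2 ⟨key r x, ?_⟩
  rw [← smul_neg, ← abs_neg x]
  exact key r (-x)

theorem abs_smul_eq [IsOrderedModule ℝ X] (r : ℝ) (x : X) : |r • x| = |r| • |x| := by
  refine le_antisymm (abs_smul_le r x) ?_
  rcases eq_or_ne r 0 with rfl | hr
  · simp [abs]
  calc |r| • |x| = |r| • |r⁻¹ • (r • x)| := by rw [inv_smul_smul₀ hr]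
    _ ≤ |r| • (|r⁻¹| • |r • x|) :=
      smul_le_smul_of_nonneg_left (abs_smul_le _ _) (abs_nonneg r)
    _ = |r • x| := by rw [abs_inv, smul_inv_smul₀ (abs_ne_zero.2 hr)]

variable [IsOrderedAddMonoid X]

theorem map_mono_of_nonneg {f : StrongDual ℝ X} (hf : ∀ x, 0 ≤ x → 0 ≤ f x) {x y : X}
    (h : x ≤ y) : f x ≤ f y := by
  have := hf _ (sub_nonneg.2 h)
  rw [map_sub] at this
  linarith

variable [HasSolidNorm X]

/-- Every continuous functional is dominated by a positive one, by the Riesz–Kantorovich formula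
`|g| x = sup {g y | |y| ≤ x}` for `x ≥ 0`. -/
theorem exists_nonneg_dominating (g : StrongDual ℝ X) :
    ∃ f : StrongDual ℝ X, (∀ x, 0 ≤ x → 0 ≤ f x) ∧ ∀ z, |g z| ≤ f |z| := by
  let q : X → ℝ := fun x => sSup (g '' {y | |y| ≤ x})
  have hle : ∀ {x y : X}, |y| ≤ x → g y ≤ ‖g‖ * ‖x‖ := fun {x y} h =>
    (le_abs_self _).trans ((g.le_opNorm y).trans (by
      gcongr
      exact norm_le_norm_of_abs_le_abs (h.trans (le_abs_self x))))
  have hbdd : ∀ x, BddAbove (g '' {y | |y| ≤ x}) := fun x =>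
    ⟨‖g‖ * ‖x‖, by rintro _ ⟨y, hy, rfl⟩; exact hle hy⟩
  have hne : ∀ {x}, 0 ≤ x → (g '' {y | |y| ≤ x}).Nonempty := fun {x} hx =>
    ⟨g 0, 0, by simpa using hx, rfl⟩
  have hq : ∀ {x y : X}, |y| ≤ x → g y ≤ q x := fun {x y} h => le_csSup (hbdd x) ⟨y, h, rfl⟩
  have hq0 : ∀ {x : X}, 0 ≤ x → 0 ≤ q x := fun {x} hx => by
    simpa using hq (x := x) (y := 0) (by simpa using hx)
  have hqle : ∀ {x : X}, 0 ≤ x → q x ≤ ‖g‖ * ‖x‖ := fun {x} hx =>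
    csSup_le (hne hx) (by rintro _ ⟨y, hy, rfl⟩; exact hle hy)
  have hqadd : ∀ {x x' : X}, 0 ≤ x → 0 ≤ x' → q (x + x') = q x + q x' := by
    intro x x' hx hx'
    apply le_antisymm
    · refine csSup_le (hne (add_nonneg hx hx')) ?_
      rintro _ ⟨y, hy, rfl⟩
      obtain ⟨y₁, y₂, rfl, h₁, h₂⟩ := exists_add_of_abs_le_add hx hx' hy
      rw [map_add]
      exact add_le_add (hq h₁) (hq h₂)
    · rw [← le_sub_iff_add_le]
      refine csSup_le (hne hx) ?_
      rintro _ ⟨y, hy, rfl⟩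
      rw [le_sub_comm]
      refine csSup_le (hne hx') ?_
      rintro _ ⟨y', hy', rfl⟩
      rw [le_sub_iff_add_le, add_comm, ← map_add]
      exact hq ((abs_add_le y y').trans (add_le_add hy hy'))
  let f₀ : X →+ ℝ := AddMonoidHom.mk' (fun x => q x⁺ - q x⁻) fun x y => by
    have h : (x + y)⁺ + (x⁻ + y⁻) = (x + y)⁻ + (x⁺ + y⁺) := by
      have h1 := posPart_sub_negPart (x + y)
      have h2 := posPart_sub_negPart x
      have h3 := posPart_sub_negPart y
      rw [sub_eq_iff_eq_add] at h1 h2 h3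
      rw [h1]
      conv_rhs => rw [h2, h3]
      abel
    have h' := congrArg q h
    rw [hqadd (posPart_nonneg _) (add_nonneg (negPart_nonneg _) (negPart_nonneg _)),
      hqadd (negPart_nonneg _) (add_nonneg (posPart_nonneg _) (posPart_nonneg _)),
      hqadd (negPart_nonneg _) (negPart_nonneg _),
      hqadd (posPart_nonneg _) (posPart_nonneg _)] at h'
    linarith
  have hpart : ∀ x : X, ‖x⁺‖ ≤ ‖x‖ ∧ ‖x⁻‖ ≤ ‖x‖ := fun x =>
    ⟨norm_le_norm_of_abs_le_abs (by
      rw [abs_of_nonneg (posPart_nonneg x)]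
      exact sup_le (le_abs_self x) (abs_nonneg x)),
    norm_le_norm_of_abs_le_abs (by
      rw [abs_of_nonneg (negPart_nonneg x)]
      exact sup_le (neg_le_abs x) (abs_nonneg x))⟩
  have hcont : Continuous f₀ := by
    refine AddMonoidHomClass.continuous_of_bound f₀ ‖g‖ fun x => ?_
    have h1 := hqle (posPart_nonneg x)
    have h2 := hqle (negPart_nonneg x)
    have h3 := hq0 (posPart_nonneg x)
    have h4 := hq0 (negPart_nonneg x)
    have h5 := mul_le_mul_of_nonneg_left (hpart x).1 (norm_nonneg g)
    have h6 := mul_le_mul_of_nonneg_left (hpart x).2 (norm_nonneg g)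
    change |q x⁺ - q x⁻| ≤ _
    rw [abs_le]
    constructor <;> linarith
  have hf : ∀ x : X, 0 ≤ x → f₀ x = q x := fun x hx => by
    change q x⁺ - q x⁻ = q x
    have h0 : q 0 = 0 := le_antisymm (by simpa using hqle (le_refl (0 : X))) (hq0 le_rfl)
    rw [posPart_of_nonneg hx, negPart_of_nonneg hx, h0, sub_zero]
  refine ⟨f₀.toRealLinearMap hcont, fun x hx => ?_, fun z => ?_⟩
  · rw [AddMonoidHom.coe_toRealLinearMap, hf x hx]
    exact hq0 hx
  · rw [AddMonoidHom.coe_toRealLinearMap, hf _ (abs_nonneg z), abs_le', ← map_neg]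
    exact ⟨hq le_rfl, hq (abs_neg z).le⟩

/-- The Hahn–Banach theorem for the seminorm `w ↦ f |w|`. -/
theorem exists_dominated_eq [IsOrderedModule ℝ X] {f : StrongDual ℝ X}
    (hf : ∀ x, 0 ≤ x → 0 ≤ f x) (z : X) :
    ∃ g : StrongDual ℝ X, g z = f |z| ∧ ∀ w, |g w| ≤ f |w| := by
  let p : Seminorm ℝ X := Seminorm.of (fun x => f |x|)
    (fun x y => by rw [← map_add]; exact map_mono_of_nonneg hf (abs_add_le x y))
    (fun r x => by rw [abs_smul_eq, map_smul]; rfl)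
  have hp : Continuous p := f.continuous.comp (continuous_id.sup continuous_neg)
  rcases eq_or_ne z 0 with rfl | hz
  · exact ⟨0, by simp, fun w => by simpa using hf _ (abs_nonneg w)⟩
  have hcoord : (LinearEquiv.coord ℝ X z hz).toLinearMap
      ⟨z, Submodule.mem_span_singleton_self z⟩ = 1 := LinearEquiv.coord_self ℝ X z hz
  obtain ⟨g, hg, hle⟩ := Module.Dual.exists_continuous_extension_of_le_seminorm (𝕜 := ℝ)
    (Submodule.span ℝ {z}) (f |z| • (LinearEquiv.coord ℝ X z hz)) hp (by
      rintro ⟨w, hw⟩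
      obtain ⟨c, rfl⟩ := Submodule.mem_span_singleton.1 hw
      have hc : (⟨c • z, hw⟩ : Submodule.span ℝ {z}) =
        c • ⟨z, Submodule.mem_span_singleton_self z⟩ := rfl
      rw [hc, map_smul, LinearMap.smul_apply, hcoord, smul_eq_mul, smul_eq_mul, mul_one,
        norm_mul, Submodule.coe_smul, map_smul_eq_mul, Real.norm_of_nonneg (hf _ (abs_nonneg z))]
      rfl)
  refine ⟨g, ?_, hle⟩
  have := hg ⟨z, Submodule.mem_span_singleton_self z⟩
  rwa [LinearMap.smul_apply, hcoord, smul_eq_mul, mul_one] at this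

end PositiveFunctionals

/-! ### Weak compactness of order intervals -/

section OrderInterval

variable {X : Type*} [NormedAddCommGroup X] [NormedSpace ℝ X]

/-- The set of affine minorants `2 r x - r² e`, `r ∈ ℝ`, of the "square" of `x` in units of `e`: if
`X` is a space of functions and `e = 1`, then its supremum is `x²`. -/
def squareMinorants (e x : X) : Set X :=
  Set.range fun r : ℝ => (2 * r) • x - r ^ 2 • e

theorem squareMinorants_nonempty (e x : X) : (squareMinorants e x).Nonempty :=
  Set.range_nonempty _

theorem zero_mem_squareMinorants (e x : X) : 0 ∈ squareMinorants e x := ⟨0, by simp⟩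

variable [Lattice X] [IsOrderedAddMonoid X] [IsOrderedModule ℝ X]

theorem le_of_mem_squareMinorants {e x y : X} (hx : x ∈ Set.Icc 0 e)
    (hy : y ∈ squareMinorants e x) : y ≤ e := by
  obtain ⟨r, rfl⟩ := hy
  obtain ⟨h0, h1⟩ := hx
  have he : 0 ≤ e := h0.trans h1
  rcases le_total 0 r with hr | hr
  · calc (2 * r) • x - r ^ 2 • e ≤ (2 * r) • e - r ^ 2 • e :=
        sub_le_sub_right (smul_le_smul_of_nonneg_left h1 (by positivity)) _
      _ = (2 * r - r ^ 2) • e := (sub_smul _ _ _).symm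
      _ ≤ (1 : ℝ) • e := smul_le_smul_of_nonneg_right (by nlinarith [sq_nonneg (r - 1)]) he
      _ = e := one_smul _ _
  · have h2 : (2 * r) • x ≤ 0 := smul_nonpos_of_nonpos_of_nonneg (by linarith) h0
    have h3 : 0 ≤ r ^ 2 • e := smul_nonneg (by positivity) he
    exact (sub_le_sub h2 h3).trans (by simpa using he)

/-- Uniform convexity of the square. Pointwise this follows from
`x² + y² - 2 ((x + y) / 2)² = (x - y)² / 2` and `(x - y)² ≥ 4 h |x - y| - 4 h²`. -/
theorem square_uniform_convex {e x y a b c : X} (ha : IsLUB (squareMinorants e x) a)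
    (hb : IsLUB (squareMinorants e y) b)
    (hc : IsLUB (squareMinorants e ((2⁻¹ : ℝ) • (x + y))) c) {h : ℝ} (hh : 0 ≤ h) :
    (2 : ℝ) • c + (2 * h) • |x - y| ≤ a + b + (2 * h ^ 2) • e := by
  have key : ∀ s : ℝ, (2 : ℝ) • c + (2 * s) • (x - y) ≤ a + b + (2 * s ^ 2) • e := by
    intro s
    have hle : c ≤ (2⁻¹ : ℝ) • (a + b + (2 * s ^ 2) • e - (2 * s) • (x - y)) := by
      refine hc.2 ?_
      rintro _ ⟨t, rfl⟩
      -- the minorants of `x` and `y` with slopes `t + s` and `t - s`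
      have h1 := ha.1 ⟨t + s, rfl⟩
      have h2 := hb.1 ⟨t - s, rfl⟩
      have h3 := smul_le_smul_of_nonneg_left (add_le_add h1 h2) (show (0 : ℝ) ≤ 2⁻¹ by norm_num)
      have h4 := add_le_add_left h3 ((2⁻¹ : ℝ) • ((2 * s ^ 2) • e - (2 * s) • (x - y)))
      calc _ = _ := by module
        _ ≤ _ := h4
        _ = _ := by module
    have h5 := smul_le_smul_of_nonneg_left hle (show (0 : ℝ) ≤ 2 by norm_num)
    rw [smul_inv_smul₀ two_ne_zero] at h5
    exact le_sub_iff_add_le.1 h5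
  have h1 := key h
  have h2 := key (-h)
  rw [← abs_of_nonneg (show 0 ≤ 2 * h by positivity), ← abs_smul_eq, ← le_sub_iff_add_le', abs_le']
  refine ⟨le_sub_iff_add_le'.2 h1, le_sub_iff_add_le'.2 ?_⟩
  rwa [neg_sq, mul_neg, neg_smul] at h2

variable [HasSolidNorm X] [CompleteSpace X]

/-- Completeness of an order interval for the `L¹`-type seminorm `f |·|` of a positive functional:
the limit of a rapidly convergent sequence is its limit superior. -/
theorem IsOrderContinuous.exists_tendsto_abs_sub (hX : IsOrderContinuous X)
    {f : StrongDual ℝ X} (hf : ∀ x, 0 ≤ x → 0 ≤ f x) {e : X} {x : ℕ → X}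
    (hx : ∀ n, x n ∈ Set.Icc 0 e) {c : ℝ} (hc : ∀ n, f |x (n + 1) - x n| ≤ c * (1 / 2) ^ n) :
    ∃ z ∈ Set.Icc 0 e, Tendsto (fun n => f |x n - z|) atTop (𝓝 0) := by
  have hc0 : 0 ≤ c := by simpa using (hf _ (abs_nonneg _)).trans (hc 0)
  choose u hu using fun n => hX.exists_isLUB (S := Set.range fun k => x (n + k))
    (Set.range_nonempty _) ⟨e, by rintro _ ⟨k, rfl⟩; exact (hx _).2⟩
  have hxu : ∀ n k, x (n + k) ≤ u n := fun n k => (hu n).1 ⟨k, rfl⟩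
  have hanti : Antitone u := antitone_nat_of_succ_le fun n => (hu (n + 1)).2 (by
    rintro _ ⟨k, rfl⟩
    have h := hxu n (1 + k)
    rwa [← add_assoc] at h)
  have hu0 : ∀ n, 0 ≤ u n := fun n => (hx n).1.trans (hxu n 0)
  obtain ⟨z, hz⟩ := hX.exists_tendsto_of_antitone hanti hu0
  have hzu : ∀ n, z ≤ u n := fun n => hanti.le_of_tendsto hz n
  refine ⟨z, ⟨ge_of_tendsto' hz hu0, (hzu 0).trans ((hu 0).2 ?_)⟩, ?_⟩
  · rintro _ ⟨k, rfl⟩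
    exact (hx _).2
  have hpart : ∀ n m, partialSups (fun k => x (n + k)) m ≤
      x n + ∑ k ∈ Finset.range m, |x (n + k + 1) - x (n + k)| := by
    intro n m
    induction m with
    | zero => simp
    | succ m ih =>
      rw [partialSups_add_one, Finset.sum_range_succ, ← add_assoc (x n)]
      refine sup_le (ih.trans (le_add_of_nonneg_right (abs_nonneg _))) ?_
      calc x (n + (m + 1)) = x (n + m) + (x (n + m + 1) - x (n + m)) := by
            rw [add_sub_cancel, add_assoc]
        _ ≤ _ := add_le_add ((le_partialSups (fun k => x (n + k)) m).trans ih) (le_abs_self _)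
  have hfu : ∀ n, f (u n - x n) ≤ 2 * c * (1 / 2) ^ n := by
    intro n
    have hlim : Tendsto (partialSups fun k => x (n + k)) atTop (𝓝 (u n)) :=
      hX.tendsto_of_monotone (partialSups_monotone _) (by
        rw [IsLUB, upperBounds_range_partialSups]
        exact hu n)
    refine le_of_tendsto' ((f.continuous.tendsto _).comp (hlim.sub_const (x n))) fun m => ?_
    calc f (partialSups (fun k => x (n + k)) m - x n)
        ≤ f (∑ k ∈ Finset.range m, |x (n + k + 1) - x (n + k)|) :=
          map_mono_of_nonneg hf (sub_le_iff_le_add'.2 (hpart n m))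
      _ = ∑ k ∈ Finset.range m, f |x (n + k + 1) - x (n + k)| := map_sum _ _ _
      _ ≤ ∑ k ∈ Finset.range m, c * (1 / 2) ^ n * (1 / 2) ^ k :=
          Finset.sum_le_sum fun k _ => (hc _).trans (by rw [pow_add, mul_assoc])
      _ = c * (1 / 2) ^ n * ∑ k ∈ Finset.range m, (1 / 2 : ℝ) ^ k := by rw [Finset.mul_sum]
      _ ≤ c * (1 / 2) ^ n * 2 := by gcongr; exact sum_geometric_two_le m
      _ = _ := by ring
  have hlim1 : Tendsto (fun n : ℕ => 2 * c * (1 / 2 : ℝ) ^ n + f (u n - z)) atTop (𝓝 0) := by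
    have h1 := (tendsto_pow_atTop_nhds_zero_of_lt_one (r := (1 / 2 : ℝ)) (by norm_num)
      (by norm_num)).const_mul (2 * c)
    have h2 := (f.continuous.tendsto _).comp (hz.sub_const z)
    simpa using h1.add h2
  refine squeeze_zero (fun n => hf _ (abs_nonneg _)) (fun n => ?_) hlim1
  calc f |x n - z| ≤ f ((u n - x n) + (u n - z)) := by
        refine map_mono_of_nonneg hf ?_
        have h1 := abs_add_le (x n - u n) (u n - z)
        rwa [sub_add_sub_cancel, abs_sub_comm (x n) (u n),
          abs_of_nonneg (sub_nonneg.2 (show x n ≤ u n from hxu n 0)),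
          abs_of_nonneg (sub_nonneg.2 (hzu n))] at h1
    _ ≤ _ := by rw [map_add]; gcongr; exact hfu n

/-- Minimising `f (x²)` over the convex members of an ultrafilter on `[0, e]`. Near-minimisers are
close to each other in the seminorm `f |·|`, because the square is uniformly convex. -/
theorem IsOrderContinuous.exists_near_minimizers (hX : IsOrderContinuous X) {e : X}
    {F : Ultrafilter X} (hF : Set.Icc 0 e ∈ F) {f : StrongDual ℝ X}
    (hf : ∀ x, 0 ≤ x → 0 ≤ f x) :
    ∃ (Φ : X → ℝ) (m : ℝ),
      (∀ C ∈ F, Convex ℝ C → ∀ δ > 0, ∃ y ∈ C ∩ Set.Icc 0 e, Φ y < m + δ) ∧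
      ∀ η > 0, ∃ C ∈ F, Convex ℝ C ∧ C ⊆ Set.Icc 0 e ∧ ∃ δ > 0, ∀ x ∈ C, ∀ y ∈ C,
        Φ x < m + δ → Φ y < m + δ → f |x - y| ≤ η := by
  have hQ : ∀ x, ∃ a, x ∈ Set.Icc 0 e → IsLUB (squareMinorants e x) a := fun x => by
    by_cases hx : x ∈ Set.Icc 0 e
    · obtain ⟨a, ha⟩ := hX.exists_isLUB (squareMinorants_nonempty e x)
        ⟨e, fun y hy => le_of_mem_squareMinorants hx hy⟩
      exact ⟨a, fun _ => ha⟩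
    · exact ⟨0, fun h => absurd h hx⟩
  choose Q hQ using hQ
  have hnonneg : ∀ x ∈ Set.Icc 0 e, 0 ≤ f (Q x) := fun x hx =>
    hf _ ((hQ x hx).1 (zero_mem_squareMinorants e x))
  have hle : ∀ x ∈ Set.Icc 0 e, f (Q x) ≤ f e := fun x hx =>
    map_mono_of_nonneg hf ((hQ x hx).2 fun y hy => le_of_mem_squareMinorants hx hy)
  have hconv : Convex ℝ (Set.Icc (0 : X) e) := convex_Icc 0 e
  let T : Set ℝ := {t | ∃ C ∈ F, Convex ℝ C ∧ ∀ y ∈ C ∩ Set.Icc 0 e, t ≤ f (Q y)}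
  have hTne : T.Nonempty := ⟨0, Set.Icc 0 e, hF, hconv, fun y hy => hnonneg y hy.2⟩
  have hTbdd : BddAbove T := ⟨f e, by
    rintro t ⟨C, hC, -, ht⟩
    obtain ⟨y, hy⟩ := F.nonempty_of_mem (inter_mem hC hF)
    exact (ht y hy).trans (hle y hy.2)⟩
  refine ⟨fun x => f (Q x), sSup T, fun C hC hCc δ hδ => ?_, fun η hη => ?_⟩
  · by_contra! hcon
    have : sSup T + δ ≤ sSup T := le_csSup hTbdd ⟨C, hC, hCc, hcon⟩
    linarith
  · have hfe : 0 ≤ f e := by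
      obtain ⟨y, hy⟩ := F.nonempty_of_mem hF
      exact hf e (hy.1.trans hy.2)
    -- `h` is chosen so that `2 δ / h + h f e ≤ η` for `δ = h²`
    set h : ℝ := η / (2 + f e) with hh
    have hpos : 0 < h := by positivity
    obtain ⟨t, ⟨C, hC, hCc, ht⟩, hlt⟩ := exists_lt_of_lt_csSup hTne
      (sub_lt_self (sSup T) (show 0 < h ^ 2 by positivity))
    refine ⟨C ∩ Set.Icc 0 e, inter_mem hC hF, hCc.inter hconv, Set.inter_subset_right, h ^ 2,
      by positivity, fun x hx y hy hxm hym => ?_⟩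
    have hmid : (2⁻¹ : ℝ) • (x + y) ∈ C ∩ Set.Icc 0 e := by
      rw [smul_add]
      exact hCc.inter hconv hx hy (by norm_num) (by norm_num) (by norm_num)
    have h1 := map_mono_of_nonneg hf (square_uniform_convex (hQ x hx.2) (hQ y hy.2)
      (hQ _ hmid.2) hpos.le)
    simp only [map_add, map_smul, smul_eq_mul] at h1
    have h2 := ht _ hmid
    have h3 : h * f |x - y| ≤ h * η := by
      have : h * (2 + f e) = η := by rw [hh]; field_simp
      rw [← this]
      nlinarith
    exact le_of_mul_le_mul_left h3 hpos

/-- A weak-* limit of an ultrafilter on `[0, e]` is represented by an element of `[0, e]` on the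
functionals dominated by a fixed positive functional. -/
theorem IsOrderContinuous.exists_eq_on_dominated (hX : IsOrderContinuous X) {e : X}
    {F : Ultrafilter X} (hF : Set.Icc 0 e ∈ F) {φ : StrongDual ℝ X → ℝ}
    (hφ : ∀ g : StrongDual ℝ X, Tendsto g F (𝓝 (φ g))) {f : StrongDual ℝ X}
    (hf : ∀ x, 0 ≤ x → 0 ≤ f x) :
    ∃ z ∈ Set.Icc 0 e, ∀ g : StrongDual ℝ X, (∀ w, |g w| ≤ f |w|) → g z = φ g := by
  obtain ⟨Φ, m, hmin, hsmall⟩ := hX.exists_near_minimizers hF hf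
  choose C hCF hCc hCe δ hδ hC using fun n : ℕ =>
    hsmall ((1 / 2 : ℝ) ^ n) (by positivity)
  choose x hx hxm using fun n => hmin (C n) (hCF n) (hCc n) (δ n) (hδ n)
  -- the distance from `x n` to points common to the `n`th slice and another convex set
  have hclose : ∀ n (D : Set X), D ∈ F → Convex ℝ D → ∀ ε > 0,
      ∃ y ∈ D, Φ y < m + ε ∧ f |x n - y| ≤ (1 / 2) ^ n := fun n D hD hDc ε hε => by
    obtain ⟨y, hy, hym⟩ := hmin (C n ∩ D) (inter_mem (hCF n) hD) ((hCc n).inter hDc)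
      (min (δ n) ε) (lt_min (hδ n) hε)
    exact ⟨y, hy.1.2, hym.trans_le (by gcongr; exact min_le_right _ _),
      hC n _ (hx n).1 _ hy.1.1 (hxm n) (hym.trans_le (by gcongr; exact min_le_left _ _))⟩
  have htri : ∀ a b c : X, f |a - c| ≤ f |a - b| + f |b - c| := fun a b c => by
    rw [← map_add]
    exact map_mono_of_nonneg hf (by simpa using abs_add_le (a - b) (b - c))
  obtain ⟨z, hz, hlim⟩ := hX.exists_tendsto_abs_sub hf (e := e) (x := x) (fun n => (hx n).2)
    (c := 2) fun n => by
      obtain ⟨y, hy, hym, hyx⟩ := hclose n (C (n + 1)) (hCF _) (hCc _) (δ (n + 1)) (hδ _)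
      have h1 := hC (n + 1) _ (hx (n + 1)).1 _ hy (hxm _) hym
      have h2 := htri (x (n + 1)) y (x n)
      rw [abs_sub_comm y] at h2
      have h3 : (1 / 2 : ℝ) ^ (n + 1) ≤ (1 / 2) ^ n :=
        pow_le_pow_of_le_one (by norm_num) (by norm_num) n.le_succ
      linarith
  refine ⟨z, hz, fun g hg => ?_⟩
  refine eq_of_abs_sub_le_all fun ε hε => ?_
  have hlim2 : Tendsto (fun n => (1 / 2 : ℝ) ^ n + f |x n - z| + ε) atTop (𝓝 (0 + 0 + ε)) :=
    ((tendsto_pow_atTop_nhds_zero_of_lt_one (by norm_num) (by norm_num)).add hlim).add_const ε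
  rw [zero_add, zero_add] at hlim2
  refine ge_of_tendsto' hlim2 fun n => ?_
  have hD : g ⁻¹' Metric.closedBall (φ g) ε ∈ F := hφ g (Metric.closedBall_mem_nhds _ hε)
  obtain ⟨y, hy, -, hyx⟩ := hclose n _ hD
    ((convex_closedBall (φ g) ε).is_linear_preimage g.toLinearMap.isLinear) 1 one_pos
  have h1 : |g y - φ g| ≤ ε := by
    rw [← Real.dist_eq]; exact Metric.mem_closedBall.1 hy
  have h2 : |g z - g y| ≤ f |x n - z| + f |x n - y| := by
    rw [← map_sub]
    refine (hg _).trans ?_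
    have := htri z (x n) y
    rwa [abs_sub_comm z (x n)] at this
  calc |g z - φ g| = |(g z - g y) + (g y - φ g)| := by rw [sub_add_sub_cancel]
    _ ≤ |g z - g y| + |g y - φ g| := abs_add_le _ _
    _ ≤ _ := by linarith

/-- In an order continuous Banach lattice, order intervals are weakly compact. -/
theorem IsOrderContinuous.isWeaklyCompact_Icc (hX : IsOrderContinuous X) (e : X) :
    IsWeaklyCompact (Set.Icc 0 e) := by
  rw [isWeaklyCompact_iff]
  intro F hF
  obtain ⟨φ, hφ⟩ := exists_bidual_limit (F := F) (r := ‖e‖) (mem_of_superset hF fun x hx => by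
    rw [mem_closedBall_zero_iff]
    exact norm_le_of_nonneg_of_le hx.1 hx.2)
  let S : StrongDual ℝ X → Set X := fun f =>
    {z | z ∈ Set.Icc 0 e ∧ ∀ g : StrongDual ℝ X, (∀ w, |g w| ≤ f |w|) → g z = φ g}
  have hSclosed : ∀ f, IsClosed (S f) := fun f => by
    have : S f = Set.Icc 0 e ∩
        ⋂ (g : StrongDual ℝ X) (_ : ∀ w, |g w| ≤ f |w|), g ⁻¹' {φ g} := by
      ext z; simp [S]
    rw [this]
    exact isClosed_Icc.inter (isClosed_iInter fun g => isClosed_iInter fun _ =>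
      isClosed_singleton.preimage g.continuous)
  have hSanti : ∀ {f f' : StrongDual ℝ X}, (∀ x, 0 ≤ x → f x ≤ f' x) → S f' ⊆ S f :=
    fun h z hz => ⟨hz.1, fun g hg => hz.2 g fun w => (hg w).trans (h _ (abs_nonneg w))⟩
  -- two representing elements differ by a null vector of `f`, so their infimum represents too
  have hSinf : ∀ f : StrongDual ℝ X, (∀ x, 0 ≤ x → 0 ≤ f x) → InfClosed (S f) := by
    intro f hf x hx y hy
    refine ⟨⟨le_inf hx.1.1 hy.1.1, inf_le_left.trans hx.1.2⟩, fun g hg => ?_⟩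
    obtain ⟨g', hg', hdom⟩ := exists_dominated_eq hf (x - y)
    have h0 : f |x - y| = 0 := by
      rw [← hg', map_sub, hx.2 g' hdom, hy.2 g' hdom, sub_self]
    rw [← hx.2 g hg, ← sub_eq_zero, ← map_sub, ← abs_nonpos_iff, ← h0]
    refine (hg _).trans (map_mono_of_nonneg hf ?_)
    have := abs_inf_sub_inf_le_abs y x x
    rwa [inf_idem, inf_comm, abs_sub_comm y x] at this
  have hSglb : ∀ f : StrongDual ℝ X, ∃ z, (∀ x, 0 ≤ x → 0 ≤ f x) → z ∈ S f ∧ IsGLB (S f) z := by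
    intro f
    by_cases hf : ∀ x, 0 ≤ x → 0 ≤ f x
    · obtain ⟨z₀, hz₀⟩ := hX.exists_eq_on_dominated hF hφ hf
      obtain ⟨z, hz, happ⟩ := hX.exists_isGLB_of_directedOn (D := S f) ⟨z₀, hz₀⟩
        (InfClosed.codirectedOn (hSinf f hf)) ⟨0, fun x hx => hx.1.1⟩
      refine ⟨z, fun _ => ⟨?_, hz⟩⟩
      rw [← (hSclosed f).closure_eq, Metric.mem_closure_iff]
      intro ε hε
      obtain ⟨x, hx, hlt⟩ := happ ε hε
      exact ⟨x, hx, by rw [dist_comm, dist_eq_norm]; exact hlt x hx le_rfl⟩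
    · exact ⟨0, fun h => absurd h hf⟩
  choose M hM using hSglb
  have hadd : ∀ {f f' : StrongDual ℝ X}, (∀ x, 0 ≤ x → 0 ≤ f x) → (∀ x, 0 ≤ x → 0 ≤ f' x) →
      ∀ x, 0 ≤ x → 0 ≤ (f + f') x := fun hf hf' x hx => add_nonneg (hf x hx) (hf' x hx)
  have hMmono : ∀ {f f' : StrongDual ℝ X}, (∀ x, 0 ≤ x → 0 ≤ f x) → (∀ x, 0 ≤ x → 0 ≤ f' x) →
      M f ≤ M (f + f') ∧ M f' ≤ M (f + f') ∧ M (f + f') ∈ S f := fun {f f'} hf hf' => by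
    have h1 : S (f + f') ⊆ S f := hSanti fun x hx => le_add_of_nonneg_right (hf' x hx)
    have h2 : S (f + f') ⊆ S f' := hSanti fun x hx => le_add_of_nonneg_left (hf x hx)
    have h3 := (hM _ (hadd hf hf')).1
    exact ⟨(hM f hf).2.1 (h1 h3), (hM f' hf').2.1 (h2 h3), h1 h3⟩
  obtain ⟨z, hz, happ⟩ := hX.exists_isLUB_of_directedOn
    (D := M '' {f | ∀ x, 0 ≤ x → 0 ≤ f x}) ⟨_, 0, fun x _ => le_rfl, rfl⟩ (by
      rintro _ ⟨f, hf, rfl⟩ _ ⟨f', hf', rfl⟩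
      exact ⟨_, ⟨f + f', hadd hf hf', rfl⟩, (hMmono hf hf').1, (hMmono hf hf').2.1⟩)
    ⟨e, by rintro _ ⟨f, hf, rfl⟩; exact (hM f hf).1.1.2⟩
  have hzS : ∀ f : StrongDual ℝ X, (∀ x, 0 ≤ x → 0 ≤ f x) → z ∈ S f := by
    intro f hf
    rw [← (hSclosed f).closure_eq, Metric.mem_closure_iff]
    intro ε hε
    obtain ⟨_, ⟨f', hf', rfl⟩, hlt⟩ := happ ε hε
    refine ⟨M (f + f'), (hMmono hf hf').2.2, ?_⟩
    rw [dist_comm, dist_eq_norm]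
    exact hlt _ ⟨_, hadd hf hf', rfl⟩ (hMmono hf hf').2.1
  refine ⟨z, (hzS 0 fun x _ => le_rfl).1, fun g => ?_⟩
  obtain ⟨f, hf, hdom⟩ := exists_nonneg_dominating g
  rw [(hzS f hf).2 g hdom]
  exact hφ g

end OrderInterval

/-! ### Disjoint sequences and copies of `ℓ₁` -/

section EllOne

/-- A bounded sequence with a lower `ℓ₁`-estimate spans a copy of `ℓ₁`. -/
theorem containsCopyOfEllOne_of_lower_bound {E : Type*} [NormedAddCommGroup E] [NormedSpace ℝ E]
    [CompleteSpace E] {x : ℕ → E} {B c : ℝ} (hB : ∀ n, ‖x n‖ ≤ B) (hc : 0 < c)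
    (hlow : ∀ (s : Finset ℕ) (a : ℕ → ℝ), c * ∑ n ∈ s, |a n| ≤ ‖∑ n ∈ s, a n • x n‖) :
    ContainsCopyOfEllOne E := by
  have hsum : ∀ a : lp (fun _ : ℕ => ℝ) 1, HasSum (fun n => |a n|) ‖a‖ := fun a => by
    have h := lp.hasSum_norm (p := 1) (by simp) a
    simpa using h
  have hbound : ∀ (a : lp (fun _ : ℕ => ℝ) 1) n, ‖a n • x n‖ ≤ |a n| * B := fun a n => by
    rw [norm_smul, Real.norm_eq_abs]
    gcongr
    exact hB n
  have hsmul : ∀ a : lp (fun _ : ℕ => ℝ) 1, Summable fun n => a n • x n := fun a =>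
    Summable.of_norm_bounded ((hsum a).summable.mul_right B) (hbound a)
  let T : lp (fun _ : ℕ => ℝ) 1 →L[ℝ] E := LinearMap.mkContinuous
    ⟨⟨fun a => ∑' n, a n • x n, fun a b => by
      rw [← (hsmul a).tsum_add (hsmul b)]
      exact tsum_congr fun n => add_smul _ _ _⟩, fun r a => by
      rw [RingHom.id_apply, ← (hsmul a).tsum_const_smul]
      exact tsum_congr fun n => mul_smul _ _ _⟩ B fun a => by
      rw [mul_comm]
      exact tsum_of_norm_bounded ((hsum a).mul_right B) (hbound a)
  have hT : ∀ a, c * ‖a‖ ≤ ‖T a‖ := fun a =>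
    le_of_tendsto_of_tendsto' ((hsum a).mul_left c) (hsmul a).hasSum.norm fun s => by
      rw [← Finset.mul_sum]
      exact hlow s a
  have hanti : AntilipschitzWith (Real.toNNReal c⁻¹) T :=
    T.antilipschitz_of_bound fun a => by
      rw [Real.coe_toNNReal _ (by positivity), inv_mul_eq_div, le_div_iff₀' hc]
      exact hT a
  exact ⟨_, ⟨T.equivRange hanti.injective (hanti.isClosed_range T.uniformContinuous)⟩⟩

theorem inf_add_le_inf_add_inf {X : Type*} [AddCommGroup X] [Lattice X]
    [IsOrderedAddMonoid X] {a b c : X} (ha : 0 ≤ a) (hb : 0 ≤ b) (hc : 0 ≤ c) :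
    a ⊓ (b + c) ≤ a ⊓ b + a ⊓ c := by
  have h1 : a ⊓ (b + c) - a ⊓ b ≤ a :=
    (sub_le_self _ (le_inf ha hb)).trans inf_le_left
  have h2 : a ⊓ (b + c) - a ⊓ b ≤ c := by
    rw [sub_le_iff_le_add', inf_add]
    exact le_inf (inf_le_left.trans (le_add_of_nonneg_right hc)) inf_le_right
  exact sub_le_iff_le_add'.1 (le_inf h1 h2)

theorem inf_sum_eq_zero {X ι : Type*} [AddCommGroup X] [Lattice X] [IsOrderedAddMonoid X]
    {s : Finset ι} {a : X} {x : ι → X} (ha : 0 ≤ a)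
    (hx : ∀ i ∈ s, 0 ≤ x i) (h : ∀ i ∈ s, a ⊓ x i = 0) : a ⊓ ∑ i ∈ s, x i = 0 := by
  classical
  induction s using Finset.induction_on with
  | empty => simpa using ha
  | insert i s hi ih =>
    rw [Finset.forall_mem_insert] at hx h
    rw [Finset.sum_insert hi]
    refine le_antisymm ?_ (le_inf ha (add_nonneg hx.1 (Finset.sum_nonneg hx.2)))
    refine (inf_add_le_inf_add_inf ha hx.1 (Finset.sum_nonneg hx.2)).trans ?_
    rw [h.1, ih hx.2 h.2, add_zero]

variable {X : Type*} [NormedAddCommGroup X] [NormedSpace ℝ X] [Lattice X] [IsOrderedAddMonoid X]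
  [IsOrderedModule ℝ X]

theorem smul_inf_smul_eq_zero {a b : X} (ha : 0 ≤ a) (hb : 0 ≤ b) (h : a ⊓ b = 0) {r s : ℝ}
    (hr : 0 ≤ r) (hs : 0 ≤ s) : (r • a) ⊓ (s • b) = 0 := by
  refine le_antisymm ?_ (le_inf (smul_nonneg hr ha) (smul_nonneg hs hb))
  set t := max r s + 1 with ht
  have htpos : 0 < t := by positivity
  have hle : (r • a) ⊓ (s • b) ≤ (t • a) ⊓ (t • b) :=
    inf_le_inf (smul_le_smul_of_nonneg_right ((le_max_left r s).trans (by simp [ht])) ha)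
      (smul_le_smul_of_nonneg_right ((le_max_right r s).trans (by simp [ht])) hb)
  have h2 : t⁻¹ • ((t • a) ⊓ (t • b)) ≤ a ⊓ b := le_inf
    ((smul_le_smul_of_nonneg_left inf_le_left (by positivity)).trans_eq
      (inv_smul_smul₀ htpos.ne' a))
    ((smul_le_smul_of_nonneg_left inf_le_right (by positivity)).trans_eq
      (inv_smul_smul₀ htpos.ne' b))
  have h3 := smul_le_smul_of_nonneg_left h2 htpos.le
  rw [smul_inv_smul₀ htpos.ne', h, smul_zero] at h3
  exact hle.trans h3

/-- The terms with nonnegative coefficients are disjoint from those with negative ones. -/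
theorem sum_abs_smul_le_abs_sum {x : ℕ → X} (hx : ∀ n, 0 ≤ x n)
    (hdisj : Pairwise fun m n => x m ⊓ x n = 0) (s : Finset ℕ) (a : ℕ → ℝ) :
    ∑ n ∈ s, |a n| • x n ≤ |∑ n ∈ s, a n • x n| := by
  set u := ∑ n ∈ s with 0 ≤ a n, |a n| • x n with hu
  set v := ∑ n ∈ s with ¬ 0 ≤ a n, |a n| • x n with hv
  have hterm : ∀ n, 0 ≤ |a n| • x n := fun n => smul_nonneg (abs_nonneg _) (hx n)
  have huv : u ⊓ v = 0 := by
    refine inf_sum_eq_zero (Finset.sum_nonneg fun n _ => hterm n) (fun n _ => hterm n)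
      fun n hn => ?_
    rw [inf_comm]
    refine inf_sum_eq_zero (hterm n) (fun n _ => hterm n) fun m hm => ?_
    refine smul_inf_smul_eq_zero (hx n) (hx m) (hdisj ?_) (abs_nonneg _) (abs_nonneg _)
    rintro rfl
    exact (Finset.mem_filter.1 hn).2 (Finset.mem_filter.1 hm).2
  have h1 : ∑ n ∈ s, |a n| • x n = u + v := (Finset.sum_filter_add_sum_filter_not s _ _).symm
  have h2 : ∑ n ∈ s, a n • x n = u - v := by
    rw [← Finset.sum_filter_add_sum_filter_not s (fun n => 0 ≤ a n), sub_eq_add_neg, hv,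
      ← Finset.sum_neg_distrib]
    refine congrArg₂ _ (Finset.sum_congr rfl fun n hn => ?_) (Finset.sum_congr rfl fun n hn => ?_)
    · rw [abs_of_nonneg (Finset.mem_filter.1 hn).2]
    · rw [abs_of_neg (not_le.1 (Finset.mem_filter.1 hn).2), neg_smul, neg_neg]
  rw [h1, h2, abs_sub_comm, ← sup_sub_inf_eq_abs_sub, huv, sub_zero, ← inf_add_sup u v, huv,
    zero_add]

variable [HasSolidNorm X]

/-- A bounded disjoint sequence on which a functional is bounded away from zero spans `ℓ₁`. -/
theorem containsCopyOfEllOne_of_disjoint {Y : Submodule ℝ X} [CompleteSpace Y] {x : ℕ → Y}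
    (hx : ∀ n, 0 ≤ (x n : X)) (hdisj : Pairwise fun m n => (x m : X) ⊓ x n = 0) {B : ℝ}
    (hB : ∀ n, ‖x n‖ ≤ B) {f : StrongDual ℝ X} {δ : ℝ} (hδ : 0 < δ) (hf : ∀ n, δ ≤ |f (x n)|) :
    ContainsCopyOfEllOne Y := by
  have hfpos : 0 < ‖f‖ := by
    refine norm_pos_iff.2 ?_
    rintro rfl
    have := hf 0
    simp at this
    linarith
  refine containsCopyOfEllOne_of_lower_bound hB (c := δ / ‖f‖) (by positivity) fun s a => ?_
  rw [div_mul_eq_mul_div, div_le_iff₀' hfpos]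
  -- replace the coefficients by the signs that make all terms of `f (∑ …)` nonnegative
  set σ : ℕ → ℝ := fun n => SignType.sign (f (x n)) * |a n| with hσ
  have hσabs : ∀ n, |σ n| ≤ |a n| := fun n => by
    rw [hσ, abs_mul, abs_abs]
    refine mul_le_of_le_one_left (abs_nonneg _) ?_
    rcases lt_trichotomy (f (x n)) 0 with h | h | h <;> simp [h]
  have hnorm : ‖∑ n ∈ s, σ n • (x n : X)‖ ≤ ‖∑ n ∈ s, a n • x n‖ := by
    change _ ≤ ‖((∑ n ∈ s, a n • x n : Y) : X)‖
    rw [Submodule.coe_sum]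
    refine norm_le_norm_of_abs_le_abs ?_
    calc |∑ n ∈ s, σ n • (x n : X)| ≤ ∑ n ∈ s, |a n| • (x n : X) := by
          rw [abs_le', ← Finset.sum_neg_distrib]
          refine ⟨Finset.sum_le_sum fun n _ => ?_, Finset.sum_le_sum fun n _ => ?_⟩
          · exact smul_le_smul_of_nonneg_right ((le_abs_self _).trans (hσabs n)) (hx n)
          · rw [← neg_smul]
            exact smul_le_smul_of_nonneg_right ((neg_le_abs _).trans (hσabs n)) (hx n)
      _ ≤ _ := sum_abs_smul_le_abs_sum hx hdisj s a
  calc δ * ∑ n ∈ s, |a n| = ∑ n ∈ s, δ * |a n| := Finset.mul_sum _ _ _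
    _ ≤ ∑ n ∈ s, σ n * f (x n) := Finset.sum_le_sum fun n _ => by
        have h1 : σ n * f (x n) = |f (x n)| * |a n| := by
          rw [hσ, ← sign_mul_self (f (x n) : ℝ)]; ring
        rw [h1]
        gcongr
        exact hf n
    _ = f (∑ n ∈ s, σ n • (x n : X)) := by simp [map_sum]
    _ ≤ ‖f‖ * ‖∑ n ∈ s, σ n • (x n : X)‖ := (le_abs_self _).trans (f.le_opNorm _)
    _ ≤ _ := by gcongr

end EllOne

/-! ### Closed ideals of order continuous Banach lattices -/

section Ideals

variable {X : Type*} [AddCommGroup X] [Module ℝ X] [Lattice X] [IsOrderedAddMonoid X]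
  {Y : Submodule ℝ X} [IsIdeal Y]

theorem IsIdeal.mem_of_nonneg_of_le {x y : X} (hy : y ∈ Y) (hx : 0 ≤ x) (h : x ≤ y) : x ∈ Y :=
  IsIdeal.solid hy (by rwa [abs_of_nonneg hx, abs_of_nonneg (hx.trans h)])

theorem IsIdeal.abs_mem {y : X} (hy : y ∈ Y) : |y| ∈ Y :=
  IsIdeal.solid hy (abs_abs y).le

theorem IsIdeal.posPart_mem {y : X} (hy : y ∈ Y) : y⁺ ∈ Y :=
  IsIdeal.mem_of_nonneg_of_le (IsIdeal.abs_mem hy) (posPart_nonneg y)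
    (sup_le (le_abs_self y) (abs_nonneg y))

theorem IsIdeal.negPart_mem {y : X} (hy : y ∈ Y) : y⁻ ∈ Y :=
  IsIdeal.mem_of_nonneg_of_le (IsIdeal.abs_mem hy) (negPart_nonneg y)
    (sup_le (neg_le_abs y) (abs_nonneg y))

end Ideals

section ClosedIdeals

variable {X : Type*} [NormedAddCommGroup X] [NormedSpace ℝ X] [Lattice X] [IsOrderedAddMonoid X]
  [IsOrderedModule ℝ X]

theorem mem_of_le_nsmul_sum {W : Submodule ℝ X} {s : Finset X}
    (hs : ∀ e ∈ s, 0 ≤ e ∧ Set.Icc 0 e ⊆ W) {n : ℕ} {a : X} (ha : 0 ≤ a)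
    (h : a ≤ n • ∑ e ∈ s, e) : a ∈ W := by
  classical
  induction s using Finset.induction_on generalizing a with
  | empty =>
    have : a = 0 := le_antisymm (by simpa using h) ha
    rw [this]
    exact W.zero_mem
  | insert e s he ih =>
    rw [Finset.forall_mem_insert] at hs
    rw [Finset.sum_insert he, nsmul_add] at h
    have hne : 0 ≤ n • e := nsmul_nonneg hs.1.1 n
    have h1 : a ⊓ n • e ∈ W := by
      rcases Nat.eq_zero_or_pos n with rfl | hn
      · rw [zero_nsmul, inf_eq_right.2 ha]
        exact W.zero_mem
      · have hn' : (0 : ℝ) < n := by exact_mod_cast hn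
        rw [← W.smul_mem_iff (inv_ne_zero hn'.ne')]
        refine hs.1.2 ⟨smul_nonneg (by positivity) (le_inf ha hne), ?_⟩
        calc (n : ℝ)⁻¹ • (a ⊓ n • e) ≤ (n : ℝ)⁻¹ • (n • e) :=
              smul_le_smul_of_nonneg_left inf_le_right (by positivity)
          _ = e := by rw [← Nat.cast_smul_eq_nsmul ℝ, inv_smul_smul₀ hn'.ne']
    have h2 : a - a ⊓ n • e ∈ W := ih hs.2 (sub_nonneg.2 inf_le_left) (by
      rw [sub_le_comm]
      exact le_inf (sub_le_self a (nsmul_nonneg (Finset.sum_nonneg fun e he => (hs.2 e he).1) n))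
        (sub_le_iff_le_add.2 h))
    simpa using W.add_mem h1 h2

theorem exists_maximal_disjoint_family (Y : Submodule ℝ X) :
    ∃ E : Set X, (∀ e ∈ E, e ∈ Y ∧ 0 ≤ e ∧ ‖e‖ = 1) ∧ (E.Pairwise fun a b => a ⊓ b = 0) ∧
      ∀ z ∈ Y, 0 ≤ z → (∀ e ∈ E, z ⊓ e = 0) → z = 0 := by
  obtain ⟨E, hE⟩ := zorn_subset
    {E : Set X | (∀ e ∈ E, e ∈ Y ∧ 0 ≤ e ∧ ‖e‖ = 1) ∧ E.Pairwise fun a b => a ⊓ b = 0}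
    (fun c hc hchain => ⟨⋃₀ c, ⟨fun e he => by
        obtain ⟨E, hE, heE⟩ := he
        exact (hc hE).1 e heE,
      (Set.pairwise_sUnion hchain.directedOn).2 fun E hE => (hc hE).2⟩,
      fun E hE => Set.subset_sUnion_of_mem hE⟩)
  refine ⟨E, hE.prop.1, hE.prop.2, fun z hz hz0 hdisj => ?_⟩
  by_contra hne
  have hnorm : ‖z‖ ≠ 0 := norm_ne_zero_iff.2 hne
  have hw0 : 0 ≤ ‖z‖⁻¹ • z := smul_nonneg (by positivity) hz0
  have hw1 : ‖‖z‖⁻¹ • z‖ = 1 := by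
    rw [norm_smul, norm_inv, norm_norm, inv_mul_cancel₀ hnorm]
  have hwdisj : ∀ e ∈ E, (‖z‖⁻¹ • z) ⊓ e = 0 := fun e he => by
    have := smul_inf_smul_eq_zero hz0 (hE.prop.1 e he).2.1 (hdisj e he)
      (inv_nonneg.2 (norm_nonneg z)) zero_le_one
    rwa [one_smul] at this
  have hmem : ‖z‖⁻¹ • z ∈ E := by
    refine hE.le_of_ge (y := insert (‖z‖⁻¹ • z) E) ⟨?_, ?_⟩ (Set.subset_insert _ _)
      (Set.mem_insert _ _)
    · rintro e (rfl | he)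
      · exact ⟨Y.smul_mem _ hz, hw0, hw1⟩
      · exact hE.prop.1 e he
    · refine hE.prop.2.insert fun e he _ => ⟨hwdisj e he, ?_⟩
      rw [inf_comm]
      exact hwdisj e he
  have := hwdisj _ hmem
  rw [inf_idem] at this
  rw [this, norm_zero] at hw1
  exact zero_ne_one hw1

/-- The disjoint complement `Y^d` of a subspace: the elements disjoint from all elements of `Y`. -/
def disjointComplement (Y : Submodule ℝ X) : Submodule ℝ X where
  carrier := {x | ∀ y ∈ Y, |x| ⊓ |y| = 0}
  zero_mem' y _ := by simp
  add_mem' {a b} ha hb y hy := by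
    refine le_antisymm ?_ (le_inf (abs_nonneg _) (abs_nonneg _))
    calc |a + b| ⊓ |y| ≤ |y| ⊓ (|a| + |b|) := by
          rw [inf_comm]; exact inf_le_inf_left _ (abs_add_le a b)
      _ ≤ |y| ⊓ |a| + |y| ⊓ |b| :=
          inf_add_le_inf_add_inf (abs_nonneg _) (abs_nonneg _) (abs_nonneg _)
      _ = 0 := by rw [inf_comm, ha y hy, inf_comm, hb y hy, add_zero]
  smul_mem' r a ha y hy := by
    have := smul_inf_smul_eq_zero (abs_nonneg a) (abs_nonneg y) (ha y hy) (abs_nonneg r)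
      zero_le_one
    rwa [one_smul, ← abs_smul_eq] at this

variable [HasSolidNorm X]

theorem isClosed_disjointComplement (Y : Submodule ℝ X) :
    IsClosed (disjointComplement Y : Set X) := by
  have : (disjointComplement Y : Set X) = ⋂ y ∈ Y, (fun x : X => |x| ⊓ |y|) ⁻¹' {0} := by
    ext x; simp [disjointComplement]
  rw [this]
  exact isClosed_iInter fun y => isClosed_iInter fun _ => isClosed_singleton.preimage
    ((continuous_id.sup continuous_neg).inf continuous_const)

variable {Y : Submodule ℝ X} [IsIdeal Y]

/-- The elements `y ⊓ n (e₁ + ⋯ + e_k)` increase to `y ∈ Y⁺`, by maximality of the family. -/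
theorem IsOrderContinuous.le_topologicalClosure_span (hX : IsOrderContinuous X) {E : Set X}
    (hE : ∀ e ∈ E, e ∈ Y ∧ 0 ≤ e ∧ ‖e‖ = 1)
    (hmax : ∀ z ∈ Y, 0 ≤ z → (∀ e ∈ E, z ⊓ e = 0) → z = 0) {K : Set X}
    (hK : ∀ e ∈ E, Set.Icc 0 e ⊆ K) : Y ≤ (Submodule.span ℝ K).topologicalClosure := by
  classical
  have hpos : ∀ y ∈ Y, 0 ≤ y → y ∈ (Submodule.span ℝ K).topologicalClosure := by
    intro y hy hy0
    have hs0 : ∀ s : Finset X, ↑s ⊆ E → ∀ e ∈ s, 0 ≤ e := fun s hs e he => (hE e (hs he)).2.1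
    refine Metric.mem_closure_iff.2 fun ε hε => ?_
    obtain ⟨_, ⟨s, hs, n, rfl⟩, hlt⟩ :=
      hX {d | ∃ s : Finset X, ↑s ⊆ E ∧ ∃ n : ℕ, d = y - y ⊓ n • ∑ e ∈ s, e}
      ⟨_, ∅, by simp, 0, rfl⟩ (by
        rintro _ ⟨s, hs, n, rfl⟩ _ ⟨t, ht, m, rfl⟩
        have hst : (↑(s ∪ t) : Set X) ⊆ E := by
          rw [Finset.coe_union]; exact Set.union_subset hs ht
        have hle : ∀ (r : Finset X) (k l : ℕ), r ⊆ s ∪ t → k ≤ l →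
            k • ∑ e ∈ r, e ≤ l • ∑ e ∈ s ∪ t, e := fun r k l hr hkl =>
          (nsmul_le_nsmul_right (Finset.sum_le_sum_of_subset_of_nonneg hr
            fun e he _ => hs0 _ hst e he) k).trans
            (nsmul_le_nsmul_left (Finset.sum_nonneg (hs0 _ hst)) hkl)
        exact ⟨_, ⟨s ∪ t, hst, max n m, rfl⟩,
          sub_le_sub_left (inf_le_inf_left _ (hle s n _ Finset.subset_union_left
            (le_max_left _ _))) _,
          sub_le_sub_left (inf_le_inf_left _ (hle t m _ Finset.subset_union_right
            (le_max_right _ _))) _⟩) (by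
        constructor
        · rintro _ ⟨s, hs, n, rfl⟩
          exact sub_nonneg.2 inf_le_left
        · intro z hz
          have hzp : ∀ s : Finset X, ↑s ⊆ E → ∀ n : ℕ, z⁺ ≤ y - y ⊓ n • ∑ e ∈ s, e :=
            fun s hs n => sup_le (hz ⟨s, hs, n, rfl⟩) (sub_nonneg.2 inf_le_left)
          have hzy : z⁺ ≤ y := by
            have := hzp ∅ (by simp) 0
            rwa [zero_nsmul, inf_eq_right.2 hy0, sub_zero] at this
          have hzY : z⁺ ∈ Y := IsIdeal.mem_of_nonneg_of_le hy (posPart_nonneg z) hzy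
          refine posPart_eq_zero.1 (hmax _ hzY (posPart_nonneg z) fun e he => ?_)
          -- `w = z⁺ ⊓ e` satisfies `n • w ≤ y` for every `n`
          have hw : ∀ n : ℕ, n • (z⁺ ⊓ e) ≤ y ⊓ n • e := by
            intro n
            induction n with
            | zero => simpa using hy0
            | succ n ih =>
              have h1 := hzp {e} (by simpa using he) n
              rw [Finset.sum_singleton] at h1
              rw [succ_nsmul, succ_nsmul]
              refine le_inf ?_ (add_le_add (ih.trans inf_le_right) inf_le_right)
              exact (add_le_add ih (inf_le_left.trans h1)).trans_eq (add_sub_cancel _ _)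
          exact le_antisymm (nonpos_of_forall_nsmul_le fun n => (hw n).trans inf_le_left)
            (le_inf (posPart_nonneg z) (hE e he).2.1)) ε hε
    refine ⟨y ⊓ n • ∑ e ∈ s, e, ?_, ?_⟩
    · refine mem_of_le_nsmul_sum (W := Submodule.span ℝ K) (s := s) (n := n)
        (fun e he => ⟨hs0 s hs e he, (hK e (hs he)).trans Submodule.subset_span⟩)
        (le_inf hy0 (nsmul_nonneg (Finset.sum_nonneg (hs0 s hs)) n)) inf_le_right
    · rw [dist_eq_norm]
      exact hlt _ ⟨s, hs, n, rfl⟩ le_rfl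
  intro y hy
  rw [← posPart_sub_negPart y]
  exact Submodule.sub_mem _ (hpos _ (IsIdeal.posPart_mem hy) (posPart_nonneg y))
    (hpos _ (IsIdeal.negPart_mem hy) (negPart_nonneg y))

variable [CompleteSpace X] [IsClosed (Y : Set X)]

/-- In an order continuous Banach lattice every closed ideal is a projection band: the component
of `x ≥ 0` in `Y` is the supremum of the elements of `Y` between `0` and `x`. -/
theorem IsOrderContinuous.isCompl_disjointComplement (hX : IsOrderContinuous X) :
    IsCompl Y (disjointComplement Y) := by
  constructor
  · refine Submodule.disjoint_def.2 fun x hx hxd => ?_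
    have := hxd x hx
    rwa [inf_idem, ← norm_eq_zero, norm_abs_eq_norm, norm_eq_zero] at this
  · have hpos : ∀ x : X, 0 ≤ x → x ∈ Y ⊔ disjointComplement Y := by
      intro x hx
      obtain ⟨p, hp, happ⟩ := hX.exists_isLUB_of_directedOn
        (D := {y | y ∈ Y ∧ 0 ≤ y ∧ y ≤ x}) ⟨0, Y.zero_mem, le_rfl, hx⟩ (by
          rintro a ⟨ha, ha0, hax⟩ b ⟨hb, hb0, hbx⟩
          refine ⟨a ⊔ b, ⟨IsIdeal.mem_of_nonneg_of_le (Y.add_mem ha hb)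
            (ha0.trans le_sup_left) ?_, ha0.trans le_sup_left, sup_le hax hbx⟩,
            le_sup_left, le_sup_right⟩
          exact sup_le (le_add_of_nonneg_right hb0) (le_add_of_nonneg_left ha0))
        ⟨x, fun y hy => hy.2.2⟩
      have hpY : p ∈ Y := by
        have hcl : p ∈ closure (Y : Set X) := Metric.mem_closure_iff.2 fun ε hε => by
          obtain ⟨y, hy, hlt⟩ := happ ε hε
          exact ⟨y, hy.1, by rw [dist_comm, dist_eq_norm]; exact hlt y hy le_rfl⟩
        rwa [IsClosed.closure_eq inferInstance] at hcl
      have hp0 : 0 ≤ p := hp.1 ⟨Y.zero_mem, le_rfl, hx⟩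
      have hpx : p ≤ x := hp.2 fun y hy => hy.2.2
      refine Submodule.mem_sup.2 ⟨p, hpY, x - p, fun y hy => ?_, add_sub_cancel p x⟩
      rw [abs_of_nonneg (sub_nonneg.2 hpx)]
      have hz0 : 0 ≤ (x - p) ⊓ |y| := le_inf (sub_nonneg.2 hpx) (abs_nonneg y)
      have hzY : (x - p) ⊓ |y| ∈ Y :=
        IsIdeal.mem_of_nonneg_of_le (IsIdeal.abs_mem hy) hz0 inf_le_right
      have h := hp.1 ⟨Y.add_mem hpY hzY, add_nonneg hp0 hz0,
        le_sub_iff_add_le'.1 inf_le_left⟩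
      exact le_antisymm (by simpa using h) hz0
    refine codisjoint_iff.2 (Submodule.eq_top_iff'.2 fun x => ?_)
    rw [← posPart_sub_negPart x]
    exact Submodule.sub_mem _ (hpos _ (posPart_nonneg x)) (hpos _ (negPart_nonneg x))

/-- Without a copy of `ℓ₁` in `Y`, a functional is small on all but finitely many of the order
intervals `[0, e]` of a bounded disjoint family. -/
theorem finite_setOf_exists_le_abs (hY : ¬ ContainsCopyOfEllOne Y) {E : Set X}
    (hE : ∀ e ∈ E, e ∈ Y ∧ 0 ≤ e ∧ ‖e‖ = 1) (hdisj : E.Pairwise fun a b => a ⊓ b = 0)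
    (f : StrongDual ℝ X) {ε : ℝ} (hε : 0 < ε) :
    {e | e ∈ E ∧ ∃ x ∈ Set.Icc 0 e, ε ≤ |f x|}.Finite := by
  by_contra hinf
  have hinf' : Set.Infinite _ := hinf
  let e := hinf'.natEmbedding
  choose x hx hfx using fun n => (e n).2.2
  have hxY : ∀ n, x n ∈ Y := fun n =>
    IsIdeal.mem_of_nonneg_of_le (hE _ (e n).2.1).1 (hx n).1 (hx n).2
  have : CompleteSpace Y := (show IsClosed (Y : Set X) from inferInstance).completeSpace_coe
  refine hY (containsCopyOfEllOne_of_disjoint (x := fun n => ⟨x n, hxY n⟩)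
    (fun n => (hx n).1) (fun m n hmn => ?_) (B := 1) (fun n => ?_) hε hfx)
  · have h0 := hdisj (e m).2.1 (e n).2.1 fun h => hmn (e.injective (Subtype.ext h))
    exact le_antisymm ((inf_le_inf (hx m).2 (hx n).2).trans h0.le) (le_inf (hx m).1 (hx n).1)
  · exact (norm_le_of_nonneg_of_le (hx n).1 (hx n).2).trans (hE _ (e n).2.1).2.2.le

/-- The intervals `[0, e]` accumulate weakly only at `0`. -/
theorem IsOrderContinuous.isWeaklyCompact_biUnion_Icc (hX : IsOrderContinuous X)
    (hY : ¬ ContainsCopyOfEllOne Y) {E : Set X}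
    (hE : ∀ e ∈ E, e ∈ Y ∧ 0 ≤ e ∧ ‖e‖ = 1) (hdisj : E.Pairwise fun a b => a ⊓ b = 0) :
    IsWeaklyCompact ({0} ∪ ⋃ e ∈ E, Set.Icc 0 e) := by
  rw [isWeaklyCompact_iff]
  intro F hF
  by_cases h : ∃ e ∈ E, Set.Icc 0 e ∈ F
  · obtain ⟨e, he, heF⟩ := h
    obtain ⟨x, hx, hlim⟩ := isWeaklyCompact_iff.1 (hX.isWeaklyCompact_Icc e) F heF
    exact ⟨x, Or.inr (Set.mem_biUnion he hx), hlim⟩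
  · refine ⟨0, Or.inl rfl, fun f => Metric.tendsto_nhds.2 fun ε hε => ?_⟩
    have hfin := finite_setOf_exists_le_abs hY hE hdisj f hε
    have hnot : (⋃ e ∈ {e | e ∈ E ∧ ∃ x ∈ Set.Icc 0 e, ε ≤ |f x|}, Set.Icc 0 e) ∉ F := by
      intro hmem
      obtain ⟨e, he, heF⟩ := (Ultrafilter.finite_biUnion_mem_iff hfin).1 hmem
      exact h ⟨e, he.1, heF⟩
    filter_upwards [hF, Ultrafilter.compl_mem_iff_notMem.2 hnot] with x hx hxn
    rw [map_zero, dist_zero_right, Real.norm_eq_abs]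
    rcases hx with rfl | hx
    · simpa using hε
    · obtain ⟨e, he, hxe⟩ := Set.mem_iUnion₂.1 hx
      by_contra! hle
      exact hxn (Set.mem_biUnion (show e ∈ {e | e ∈ E ∧ ∃ x ∈ Set.Icc 0 e, ε ≤ |f x|} from
        ⟨he, x, hxe, hle⟩) hxe)

/-- A weakly compact generating set of the quotient lifts along `X ⧸ Y ≃ Y^d`. -/
theorem IsOrderContinuous.isWCG_of_quotient (hX : IsOrderContinuous X)
    (hY : ¬ ContainsCopyOfEllOne Y) (h : IsWCG (X ⧸ Y)) : IsWCG X := by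
  obtain ⟨K, hK, hgen⟩ := h
  obtain ⟨E, hE, hdisj, hmax⟩ := exists_maximal_disjoint_family Y
  have htop : Submodule.IsTopCompl Y (disjointComplement Y) :=
    Submodule.isTopCompl_iff_isCompl_isClosed.2
      ⟨hX.isCompl_disjointComplement, inferInstance, isClosed_disjointComplement Y⟩
  let σ : (X ⧸ Y) →L[ℝ] X := (disjointComplement Y).subtypeL ∘L
    (Submodule.quotientEquivOfIsTopCompl Y (disjointComplement Y) htop).toContinuousLinearMap
  have hσ : ∀ k, Y.mkQ (σ k) = k := fun k =>
    (Submodule.quotientEquivOfIsTopCompl Y (disjointComplement Y) htop).symm_apply_apply k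
  refine ⟨σ '' K ∪ ({0} ∪ ⋃ e ∈ E, Set.Icc 0 e),
    (hK.image σ).union (hX.isWeaklyCompact_biUnion_Icc hY hE hdisj), ?_⟩
  set Z := (Submodule.span ℝ (σ '' K ∪ ({0} ∪ ⋃ e ∈ E, Set.Icc 0 e))).topologicalClosure
  have hYZ : Y ≤ Z := hX.le_topologicalClosure_span hE hmax fun e he x hx =>
    Or.inr (Or.inr (Set.mem_biUnion he hx))
  refine eq_top_of_map_mkQ_eq_top hYZ (top_le_iff.1 (hgen.symm.le.trans ?_))
  refine Submodule.topologicalClosure_minimal _ (Submodule.span_le.2 fun k hk => ?_)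
    (isClosed_map_mkQ hYZ (Submodule.isClosed_topologicalClosure _))
  exact ⟨σ k, Submodule.le_topologicalClosure _ (Submodule.subset_span (Or.inl ⟨k, hk, rfl⟩)),
    hσ k⟩

end ClosedIdeals

end BanachLattice

open BanachLattice in
theorem theorem5p4 {X : Type*} [NormedAddCommGroup X] [NormedSpace ℝ X] [CompleteSpace X]
    [Lattice X] [IsOrderedAddMonoid X] [IsOrderedModule ℝ X] [HasSolidNorm X]
    (Y : Submodule ℝ X) [IsClosed (Y : Set X)] [IsIdeal Y] :
    (IsLWCG X → IsLWCG (X ⧸ Y)) ∧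
    (IsReflexive Y → IsLWCG (X ⧸ Y) → IsLWCG X) ∧
    (IsOrderContinuous X → ¬ ContainsCopyOfEllOne Y → IsWCG (X ⧸ Y) → IsWCG X) := by
  exact ⟨IsLWCG.quotient, isLWCG_of_isReflexive,
    fun hX hY h => hX.isWCG_of_quotient hY h⟩
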